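/- Let $\Bbbk$ be an algebraically closed field of characteristic zero; varieties are integral separated schemes of finite type over $\Bbbk$, and points are closed points. Let $r,w\in\mathbb{N}_+$, and let $\mathbb{G}_a^r\rtimes_w\mathbb{G}_m$ be the semi-direct product in which $\mathbb{G}_m$ acts on $\mathfrak u:=\mathrm{Lie}(\mathbb{G}_a^r)$ by scalar multiplication with weight $w$. **Situation.** $\pi:C\to S$ is an affine cone of varieties, i.e. an affine morphism of varieties with a grading $\mathcal A:=\pi_*\mathcal O_C=\bigoplus_{n\ge 0}\mathcal A_n$ by quasi-coherent $\mathcal{O}_S$-modules such that $\mathcal A_0=\mathcal O_S$; equivalently $\mathbb{G}_m$ acts on $C$ over $S$, with $t$ multiplying functions in $\mathcal A_n$ by $t^n$. The group $\mathbb{G}_a^r$ acts on $C$ such that $\pi$ is invariant, and the two actions form an action of $\mathbb{G}_a^r\rtimes_w\mathbb{G}_m$. Let $Z=\mathbb V(\bigoplus_{n>0}\mathcal A_n)\subseteq C$ be the zero section. **Index.** For $x\in C$ let $\mathrm{Stab}_{\mathfrak u}(x)\subseteq\mathfrak u$ be the subspace of those $\xi$ whose vector field on $C$ vanishes at $x$.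 Let $\mathcal Q(\pi)$ be the cokernel of the morphism $\Omega_{\mathcal A/\mathcal A_0}\to\mathfrak u^*\otimes\mathcal A$, $\mathrm df\mapsto(\xi\mapsto\xi.f)$, and let $\mathrm{Fit}_j(\mathcal Q(\pi))\subseteq\mathcal A$ be its Fitting ideals ($\mathrm{Fit}_{-1}=0$). Put $$d(\pi):=\min_{z\in Z}\dim\mathrm{Stab}_{\mathfrak u}(z),\qquad e(\pi):=\min\{n\in\mathbb N:\mathrm{Fit}_{d(\pi)-1}(\mathcal Q(\pi))\cap\mathcal A_n\neq0\},$$ with $e(\pi):=\infty$ if $\mathrm{Fit}_{d(\pi)-1}(\mathcal Q(\pi))=0$. Thus $(d(\pi),e(\pi))\in\mathbb N\times\overline{\mathbb N_+}$, where $\overline{\mathbb N_+}=\mathbb N_+\sqcup\{\infty\}$, and $\mathbb N\times\overline{\mathbb N_+}$ is ordered lexicographically. **Modification.** Let $V\subsetneq C$ be a $\mathbb{G}_a^r\rtimes_w\mathbb{G}_m$-invariant closed subscheme, and $\mathrm{Bl}_V(C)\to C$ the blowing up with the induced $\mathbb{G}_m$-action. The modification of $\pi$ along $V$ is $\pi':C'\to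 S'$, where $C'\subseteq\mathrm{Bl}_V(C)$ is the open stratum of the Białynicki-Birula stratification (the non-empty open subset consisting of the points $x$ whose limit $\lim_{t\to0}t.x$ lies in a certain connected component of the fixed locus), and $\pi':C'\to S'$ is an affine cone of varieties with a $\mathbb{G}_a^r\rtimes_w\mathbb{G}_m$-action as in the Situation, lying over a morphism $S'\to S$ such that $C'\to C$ is $\mathbb{G}_a^r\rtimes_w\mathbb{G}_m$-equivariant. **Proposition.** Let $\mathbb{G}_a^r\rtimes_w\mathbb{G}_m$ act on $\pi:C\to S$ as in the Situation. Assume that $\dim\mathrm{Stab}_{\mathfrak u}(z)=d(\pi)$ for all $z\in Z$ and that $e(\pi)<\infty$. Let $\pi':C'\to S'$ be the modification of $\pi$ along $\mathbb{G}_a^r.Z$, the scheme-theoretic image of $\mathbb{G}_a^r\times Z\to C$, $(u,z)\mapsto u.z$. Then $$(d(\pi'),e(\pi'))<(d(\pi),e(\pi))\quad\text{in }\mathbb N\times\overline{\mathbb N_+}.$$ -/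

import Mathlib

open CategoryTheory AlgebraicGeometry

universe u

noncomputable section

/-! ### Actions of `𝔾ₐʳ` on affine schemes and the module `Q` -/

/-- A `𝔾ₐʳ`-action on `Spec A` over `Spec A₀`, as a co-action `A → A[u₁, …, uᵣ] = 𝒪(𝔾ₐʳ) ⊗ A`:
the function `σ f` is `(u, x) ↦ f (u.x)`.  Being `A₀`-linear means that `Spec A → Spec A₀` is
invariant. -/
structure GaCoaction (r : ℕ) (A₀ A : Type u) [CommRing A₀] [CommRing A] [Algebra A₀ A] where
  /-- the co-action map -/
  σ : A →ₐ[A₀] MvPolynomial (Fin r) A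
  /-- `0.x = x` -/
  counit : ∀ f : A, MvPolynomial.constantCoeff (σ f) = f
  /-- `u.(v.x) = (u + v).x`, as an identity in `A[u][v]` -/
  coassoc : ∀ f : A,
    MvPolynomial.map σ.toRingHom (σ f) =
      MvPolynomial.eval₂ (MvPolynomial.C.comp MvPolynomial.C)
        (fun i => MvPolynomial.X i + MvPolynomial.C (MvPolynomial.X i)) (σ f)

namespace GaCoaction

variable {r : ℕ} {A₀ A : Type u} [CommRing A₀] [CommRing A] [Algebra A₀ A]
  (a : GaCoaction r A₀ A)

/-- The vector fields on `Spec A` given by the standard basis of the Lie algebra of `𝔾ₐʳ`: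
`ξᵢ f = (∂/∂uᵢ) (σ f)` at `u = 0`. Together they form a derivation `A → 𝔲* ⊗ A = Aʳ`. -/
def vectorFields : Derivation A₀ A (Fin r → A) :=
  Derivation.mk'
    { toFun := fun f i => MvPolynomial.constantCoeff (MvPolynomial.pderiv i (a.σ f))
      map_add' := fun f g => by ext i; simp
      map_smul' := fun c f => by
        ext i
        rw [map_smul, ← algebraMap_smul A c (a.σ f), Derivation.map_smul]
        simp [Algebra.smul_def] }
    (fun f g => by
      ext i
      simp [Derivation.leibniz, a.counit])

/-- The morphism `Ω_{A/A₀} → 𝔲* ⊗ A`. -/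
def conormalMap : Ω[A⁄A₀] →ₗ[A] (Fin r → A) := a.vectorFields.liftKaehlerDifferential

/-- `Q = coker (Ω_{A/A₀} → 𝔲* ⊗ A)`. -/
abbrev Q : Type u := (Fin r → A) ⧸ LinearMap.range a.conormalMap

/-- The ideal of the scheme theoretic image of `𝔾ₐʳ × V(I) → Spec A`, i.e. the kernel of
`A → (A/I)[u₁, …, uᵣ]`. -/
def sweepIdeal (I : Ideal A) : Ideal A :=
  RingHom.ker ((MvPolynomial.map (Ideal.Quotient.mk I)).comp a.σ.toRingHom)

end GaCoaction

/-- The `j`-th Fitting ideal of a module `M` with `n` generators, given by a surjection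
`q : Rⁿ → M`: it is generated by the `(n - j) × (n - j)`-minors of the matrices whose rows
are relations, i.e. elements of `ker q`. It is `0` for `j < 0` and `R` for `j ≥ n`. -/
def fittingIdeal {R M : Type u} [CommRing R] [AddCommGroup M] [Module R M] {n : ℕ}
    (q : (Fin n → R) →ₗ[R] M) (j : ℤ) : Ideal R :=
  Ideal.span {m | ∃ (rel : Fin ((n : ℤ) - j).toNat → LinearMap.ker q)
    (col : Fin ((n : ℤ) - j).toNat → Fin n),
      m = (Matrix.of fun s t => (rel s : Fin n → R) (col t)).det}

/-! ### Affine cones with an action of `𝔾ₐʳ ⋊_w 𝔾ₘ` -/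

/-- The ring of functions on `π⁻¹(U)` is an algebra over the ring of functions on `U`. -/
instance preimageSectionsAlgebra {C S : Scheme.{u}} (π : C ⟶ S) (U : S.Opens) :
    Algebra Γ(S, U) Γ(C, π ⁻¹ᵁ U) :=
  (π.app U).hom.toAlgebra

/-- Restriction of functions from `π⁻¹(U)` to `π⁻¹(V)` for `V ⊆ U`. -/
def preimageRes {C S : Scheme.{u}} (π : C ⟶ S) {V U : S.Opens} (h : V ≤ U) :
    Γ(C, π ⁻¹ᵁ U) →+* Γ(C, π ⁻¹ᵁ V) :=
  (C.presheaf.map (homOfLE (π.preimage_mono h)).op).hom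

/-- The constant functions on an open subset of a scheme over a field. -/
def scalar {k : Type u} [Field k] {Y : Scheme.{u}} (s : Y ⟶ Spec (.of k)) (V : Y.Opens) :
    k →+* Γ(Y, V) :=
  (s.appLE ⊤ V le_top).hom.comp (Scheme.ΓSpecIso (.of k)).inv.hom

/-- An affine cone of varieties `π : C → S` over `k` together with an action of
`𝔾ₐʳ ⋊_w 𝔾ₘ` on `C` such that `π` is `𝔾ₐʳ`-invariant and the `𝔾ₘ`-action is the one given by
the cone structure (`t` multiplies functions of degree `n` by `tⁿ`). -/
structure GradedCone (k : Type u) [Field k] (r w : ℕ) where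
  /-- the total space -/
  C : Scheme.{u}
  /-- the base -/
  S : Scheme.{u}
  /-- the projection -/
  π : C ⟶ S
  /-- the structure morphism of the base -/
  str : S ⟶ Spec (.of k)
  integral_C : IsIntegral C
  integral_S : IsIntegral S
  separated_S : IsSeparated str
  quasiCompact_S : QuasiCompact str
  finiteType_S : LocallyOfFiniteType str
  finiteType_C : LocallyOfFiniteType (π ≫ str)
  affine_π : IsAffineHom π
  /-- the homogeneous parts `𝒜ₙ` of `𝒜 = π_* 𝒪_C`, on affine open subsets of `S` -/
  𝒜 : (U : S.affineOpens) → ℕ → AddSubgroup Γ(C, π ⁻¹ᵁ U.1)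
  graded : ∀ U, SetLike.GradedMonoid (𝒜 U)
  decomposition : ∀ U, DirectSum.IsInternal (𝒜 U)
  /-- `𝒜₀ = 𝒪_S` -/
  injective_app : ∀ U : S.affineOpens, Function.Injective (π.app U.1).hom
  mem_zero_iff : ∀ (U : S.affineOpens) (f : Γ(C, π ⁻¹ᵁ U.1)),
    f ∈ 𝒜 U 0 ↔ f ∈ (π.app U.1).hom.range
  res_mem : ∀ (U V : S.affineOpens) (h : V.1 ≤ U.1) (n : ℕ), ∀ f ∈ 𝒜 U n,
    preimageRes π h f ∈ 𝒜 V n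
  /-- the action of `𝔾ₐʳ` on `C` over `S` -/
  coaction : (U : S.affineOpens) → GaCoaction r Γ(S, U.1) Γ(C, π ⁻¹ᵁ U.1)
  coaction_res : ∀ (U V : S.affineOpens) (h : V.1 ≤ U.1) (f : Γ(C, π ⁻¹ᵁ U.1)),
    (coaction V).σ (preimageRes π h f) = MvPolynomial.map (preimageRes π h) ((coaction U).σ f)
  /-- The actions of `𝔾ₐʳ` and `𝔾ₘ` form an action of `𝔾ₐʳ ⋊_w 𝔾ₘ`, that is
  `t.(u.x) = (tʷu).(t.x)`: the co-action is homogeneous when the coordinates of `𝔾ₐʳ` are given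
  the degree `w`. -/
  coeff_mem : ∀ (U : S.affineOpens) (n : ℕ), ∀ f ∈ 𝒜 U n, ∀ m : Fin r →₀ ℕ,
    (∀ j, j + w * m.degree = n → MvPolynomial.coeff m ((coaction U).σ f) ∈ 𝒜 U j) ∧
      (n < w * m.degree → MvPolynomial.coeff m ((coaction U).σ f) = 0)

namespace GradedCone

variable {k : Type u} [Field k] {r w : ℕ} (X : GradedCone k r w)

/-- The Lie algebra stabiliser of a point `x` in `𝔲 = kʳ`: those `∑ cᵢ ξᵢ` whose vector field
vanishes at `x`. -/
def stab (x : X.C) : Submodule k (Fin r → k) where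
  carrier := {c | ∀ (U : X.S.affineOpens) (hx : x ∈ X.π ⁻¹ᵁ U.1) (f : Γ(X.C, X.π ⁻¹ᵁ U.1)),
    X.C.evaluation (X.π ⁻¹ᵁ U.1) x hx
      (∑ i, scalar (X.π ≫ X.str) _ (c i) * (X.coaction U).vectorFields f i) = 0}
  zero_mem' := fun U hx f => by simp
  add_mem' := fun {a b} ha hb U hx f => by
    simpa [add_mul, Finset.sum_add_distrib, ha U hx f] using
      (congrArg₂ (· + ·) (ha U hx f) (hb U hx f))
  smul_mem' := fun c a ha U hx f => by
    have h := congrArg (X.C.evaluation (X.π ⁻¹ᵁ U.1) x hx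
      (scalar (X.π ≫ X.str) _ c) * ·) (ha U hx f)
    simpa [mul_assoc, ← Finset.mul_sum] using h

/-- The closed points of the zero section `Z = V(⨁_{n > 0} 𝒜ₙ)`. -/
def zeroSection : Set X.C :=
  {z | IsClosed {z} ∧ ∀ (U : X.S.affineOpens) (hz : z ∈ X.π ⁻¹ᵁ U.1) (n : ℕ), 0 < n →
    ∀ f ∈ X.𝒜 U n, X.C.evaluation (X.π ⁻¹ᵁ U.1) z hz f = 0}

/-- The ideal `𝒜_{>0}` of the zero section. -/
def irrelevantIdeal (U : X.S.affineOpens) : Ideal Γ(X.C, X.π ⁻¹ᵁ U.1) :=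
  Ideal.span (⋃ n > 0, (X.𝒜 U n : Set Γ(X.C, X.π ⁻¹ᵁ U.1)))

/-- `d(π)`, the minimum of `dim Stab_𝔲 (z)` for `z ∈ Z`. -/
def d : ℕ := sInf ((fun z => Module.finrank k (X.stab z)) '' X.zeroSection)

/-- The Fitting ideal `Fit_j (Q(π))` over an affine open subset of `S`. -/
def fit (j : ℤ) (U : X.S.affineOpens) : Ideal Γ(X.C, X.π ⁻¹ᵁ U.1) :=
  fittingIdeal (M := (X.coaction U).Q) (Submodule.mkQ _) j

/-- `e(π)`, the smallest `n` with `Fit_{d(π)-1} (Q(π)) ∩ 𝒜ₙ ≠ 0`, or `∞`. -/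
def e : ℕ∞ :=
  sInf ((fun n : ℕ => (n : ℕ∞)) ''
    {n | ∃ U : X.S.affineOpens, ∃ f ∈ X.fit ((X.d : ℤ) - 1) U, f ∈ X.𝒜 U n ∧ f ≠ 0})

/-- The index `(d(π), e(π))` in `ℕ × (ℕ₊ ∪ {∞})` with the lexicographic order. -/
def index : ℕ ×ₗ ℕ∞ := toLex (X.d, X.e)

/-- The ideal of the centre `𝔾ₐʳ.Z`, the scheme theoretic image of `𝔾ₐʳ × Z → C`. -/
def centre (U : X.S.affineOpens) : Ideal Γ(X.C, X.π ⁻¹ᵁ U.1) :=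
  (X.coaction U).sweepIdeal (X.irrelevantIdeal U)

/-! ### Blowing up -/

/-- For a sheaf of ideals `J` on `C`, given on the open subsets `π⁻¹(U)`, and a morphism
`f : T → C`: the inverse image ideal `f⁻¹J · 𝒪_T` is the ideal of an effective Cartier divisor. -/
def PullsBackToCartier (J : (U : X.S.affineOpens) → Ideal Γ(X.C, X.π ⁻¹ᵁ U.1))
    {T : Scheme.{u}} (f : T ⟶ X.C) : Prop :=
  ∀ (U : X.S.affineOpens) (t : T), t ∈ f ⁻¹ᵁ X.π ⁻¹ᵁ U.1 →
    ∃ (W : T.affineOpens) (h : W.1 ≤ f ⁻¹ᵁ X.π ⁻¹ᵁ U.1), t ∈ W.1 ∧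
      ∃ g ∈ nonZeroDivisors Γ(T, W.1),
        (J U).map (f.appLE (X.π ⁻¹ᵁ U.1) W.1 h).hom = Ideal.span {g}

/-- `b : B → C` is the blowing up of `C` along the ideal `J`, by its universal property. -/
structure IsBlowup (J : (U : X.S.affineOpens) → Ideal Γ(X.C, X.π ⁻¹ᵁ U.1))
    {B : Scheme.{u}} (b : B ⟶ X.C) : Prop where
  cartier : X.PullsBackToCartier J b
  lift : ∀ {T : Scheme.{u}} (f : T ⟶ X.C), X.PullsBackToCartier J f → ∃! g : T ⟶ B, g ≫ b = f

end GradedCone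

/-! ### Limits and the Białynicki-Birula stratification -/

section BialynickiBirula

variable {k : Type u} [Field k] {B : Scheme.{u}} (s : B ⟶ Spec (.of k))
  (φ : kˣ → (B ⟶ B))

/-- The closed point `t` of the affine line. -/
def linePoint (t : k) : Spec (.of (Polynomial k)) :=
  Spec.map (CommRingCat.ofHom (Polynomial.evalRingHom t)) (IsLocalRing.closedPoint k)

/-- `lim_{t → 0} t.x = y` for `𝔾ₘ` acting through `φ`: the orbit map `t ↦ t.x` extends to a
morphism from the affine line that sends `0` to `y`. -/
def HasLimit (x y : B) : Prop :=
  ∃ ℓ : Spec (.of (Polynomial k)) ⟶ B,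
    ℓ ≫ s = Spec.map (CommRingCat.ofHom Polynomial.C) ∧
      (∀ t : kˣ, ℓ (linePoint (t : k)) = φ t x) ∧ ℓ (linePoint 0) = y

/-- The closed fixed points of `𝔾ₘ`. -/
def fixedPoints : Set B := {x | IsClosed {x} ∧ ∀ t, φ t x = x}

/-- The open subset `V` is the open stratum of the Białynicki-Birula stratification: it is
non-empty and its closed points are those whose limit lies in one fixed connected component of the
fixed locus. -/
def IsOpenStratum (V : B.Opens) : Prop :=
  (V : Set B).Nonempty ∧ ∃ x₀ ∈ fixedPoints φ, ∀ x : B, IsClosed {x} →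
    (x ∈ V ↔ ∃ y ∈ connectedComponentIn (fixedPoints φ) x₀, HasLimit s φ x y)

end BialynickiBirula

/-! ### Modifications -/

namespace GradedCone

variable {k : Type u} [Field k] {r w : ℕ}

/-- `X'` is the modification of `X` along the closed subscheme with ideal `J`: with
`b : B → C` the blowing up along `J`, the total space `C'` of `X'` is the open stratum of the
Białynicki-Birula stratification of `B`, and the morphism `C' → C` is equivariant for
`𝔾ₐʳ ⋊_w 𝔾ₘ`. -/
structure Modification (X : GradedCone k r w)
    (J : (U : X.S.affineOpens) → Ideal Γ(X.C, X.π ⁻¹ᵁ U.1)) (X' : GradedCone k r w) where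
  /-- the blowing up -/
  B : Scheme.{u}
  /-- the blowing up morphism -/
  b : B ⟶ X.C
  isBlowup : X.IsBlowup J b
  /-- the action of `𝔾ₘ` on the blowing up -/
  φ : kˣ → (B ⟶ B)
  /-- `b` is `𝔾ₘ`-equivariant: `b (t.x)` and `b (x)` have the same image in `S`, and
  `f (b (t.x)) = tⁿ f (b (x))` for `f` of degree `n`. By the universal property of
  `b` this determines `φ`. -/
  φ_π : ∀ t, φ t ≫ b ≫ X.π = b ≫ X.π
  φ_smul : ∀ (t : kˣ) (U : X.S.affineOpens) (n : ℕ), ∀ f ∈ X.𝒜 U n,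
    ∀ h : b ⁻¹ᵁ X.π ⁻¹ᵁ U.1 ≤ (φ t ≫ b) ⁻¹ᵁ X.π ⁻¹ᵁ U.1,
      ((φ t ≫ b).appLE (X.π ⁻¹ᵁ U.1) (b ⁻¹ᵁ X.π ⁻¹ᵁ U.1) h).hom f =
        scalar (b ≫ X.π ≫ X.str) _ ((t : k) ^ n) * (b.app (X.π ⁻¹ᵁ U.1)).hom f
  /-- the inclusion of `C'` into the blowing up -/
  ι : X'.C ⟶ B
  isOpenImmersion : IsOpenImmersion ι
  isOpenStratum : IsOpenStratum (b ≫ X.π ≫ X.str) φ ι.opensRange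
  /-- the morphism of the bases -/
  q : X'.S ⟶ X.S
  q_str : q ≫ X.str = X'.str
  comm : X'.π ≫ q = ι ≫ b ≫ X.π
  /-- `p = ι ≫ b : C' → C` is `𝔾ₘ`-equivariant -/
  map_mem : ∀ (U : X.S.affineOpens) (U' : X'.S.affineOpens)
    (h : X'.π ⁻¹ᵁ U'.1 ≤ (ι ≫ b) ⁻¹ᵁ X.π ⁻¹ᵁ U.1), U'.1 ≤ q ⁻¹ᵁ U.1 →
    ∀ (n : ℕ), ∀ f ∈ X.𝒜 U n,
      ((ι ≫ b).appLE (X.π ⁻¹ᵁ U.1) (X'.π ⁻¹ᵁ U'.1) h).hom f ∈ X'.𝒜 U' n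
  /-- `p = ι ≫ b : C' → C` is `𝔾ₐʳ`-equivariant -/
  map_coaction : ∀ (U : X.S.affineOpens) (U' : X'.S.affineOpens)
    (h : X'.π ⁻¹ᵁ U'.1 ≤ (ι ≫ b) ⁻¹ᵁ X.π ⁻¹ᵁ U.1), U'.1 ≤ q ⁻¹ᵁ U.1 →
    ∀ f : Γ(X.C, X.π ⁻¹ᵁ U.1),
      (X'.coaction U').σ (((ι ≫ b).appLE (X.π ⁻¹ᵁ U.1) (X'.π ⁻¹ᵁ U'.1) h).hom f) =
        MvPolynomial.map ((ι ≫ b).appLE (X.π ⁻¹ᵁ U.1) (X'.π ⁻¹ᵁ U'.1) h).hom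
          ((X.coaction U).σ f)

end GradedCone

end

/-!
The vector fields `ξᵢ` of a basis of `𝔲` lower degrees by `w`. After shrinking `S` one finds
functions `sⱼ` of degree `w`, `r - d` in number, with `ξ_{cⱼ'} sⱼ = δⱼⱼ'`: a slice. Such a slice
pulls back to `C'`, so `d` does not increase.

Correcting `ξᵢ` by the slice gives the transverse fields `ρᵢ`, which kill the `sⱼ`; in terms of
them, `Fit_{d - 1}` is the ideal generated by the values `ρᵢ f`. Here `f` can be taken in the ideal
of the centre, because the `ρᵢ` kill a retraction onto `𝔾ₐʳ.Z` defined by the slice; so `ρᵢ f ≠ 0`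
for some `f` of degree at most `e + w` in that ideal. On `C'` that ideal is generated, generically
along the zero section, by one element, which has the degree `δ > 0` of a member `g` of least degree
and satisfies `ρᵢ g = 0`. Dividing `f` by `g` therefore gives `ρᵢ (f / g) = ρᵢ f / g`, of degree at
most `e - δ < e`.
-/

noncomputable section

namespace GaCoaction

open HomogeneousIdeal

section VectorField

/-- The co-multiplication `R[v] → R[v][u]`, `v ↦ u + v` of `𝔾ₐʳ`, the inner variables being the
`v`. -/
def translate (ι R : Type*) [CommRing R] :
    MvPolynomial ι R →+* MvPolynomial ι (MvPolynomial ι R) :=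
  MvPolynomial.eval₂Hom (MvPolynomial.C.comp MvPolynomial.C)
    fun i => MvPolynomial.X i + MvPolynomial.C (MvPolynomial.X i)

theorem constantCoeff_translate {ι R : Type*} [CommRing R] (P : MvPolynomial ι R) :
    MvPolynomial.constantCoeff (translate ι R P) = P := by
  induction P using MvPolynomial.induction_on with
  | C c => simp [translate]
  | add P Q hP hQ => rw [map_add, map_add, hP, hQ]
  | mul_X P j hP => rw [map_mul, map_mul, hP]; simp [translate]

theorem constantCoeff_pderiv_translate {ι R : Type*} [CommRing R] (i : ι) (P : MvPolynomial ι R) :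
    MvPolynomial.constantCoeff (MvPolynomial.pderiv i (translate ι R P)) =
      MvPolynomial.pderiv i P := by
  classical
  induction P using MvPolynomial.induction_on with
  | C c => simp [translate]
  | add P Q hP hQ => simp only [map_add, hP, hQ]
  | mul_X P j hP =>
    have hX : translate ι R (.X j) = .X j + .C (.X j) := by simp [translate]
    simp only [map_mul, Derivation.leibniz, map_add, smul_eq_mul, hP, constantCoeff_translate, hX,
      MvPolynomial.pderiv_C, MvPolynomial.pderiv_X, MvPolynomial.constantCoeff_X,
      MvPolynomial.constantCoeff_C, zero_add, add_zero]
    obtain rfl | h := eq_or_ne i j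
    · simp
    · simp [Pi.single_eq_of_ne' h]

variable {r : ℕ} {A₀ A : Type u} [CommRing A₀] [CommRing A] [Algebra A₀ A]
  (a : GaCoaction r A₀ A)

/-- The vector field `ξᵢ` of the `i`-th basis vector of the Lie algebra of `𝔾ₐʳ`. -/
def vectorField (i : Fin r) : Derivation A₀ A A :=
  (LinearMap.proj i : (Fin r → A) →ₗ[A] A).compDer a.vectorFields

theorem vectorFields_apply (f : A) (i : Fin r) : a.vectorFields f i = a.vectorField i f := rfl

theorem vectorField_eq_constantCoeff (i : Fin r) (f : A) :
    a.vectorField i f = MvPolynomial.constantCoeff (MvPolynomial.pderiv i (a.σ f)) := rfl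

theorem vectorField_eq_coeff (i : Fin r) (f : A) :
    a.vectorField i f = MvPolynomial.coeff (Finsupp.single i 1) (a.σ f) := by
  rw [vectorField_eq_constantCoeff, MvPolynomial.constantCoeff_eq, MvPolynomial.coeff_pderiv]
  simp

theorem σ_vectorField (i : Fin r) (f : A) :
    a.σ (a.vectorField i f) = MvPolynomial.pderiv i (a.σ f) := by
  have h : MvPolynomial.map a.σ.toRingHom (a.σ f) = translate (Fin r) A (a.σ f) := a.coassoc f
  rw [← constantCoeff_pderiv_translate, ← h, MvPolynomial.pderiv_map,
    MvPolynomial.constantCoeff_map]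
  rfl

theorem vectorField_comm (i j : Fin r) (f : A) :
    a.vectorField i (a.vectorField j f) = a.vectorField j (a.vectorField i f) := by
  simp only [a.vectorField_eq_constantCoeff _ (a.vectorField _ f), σ_vectorField,
    MvPolynomial.constantCoeff_eq, MvPolynomial.coeff_pderiv]
  obtain rfl | h := eq_or_ne i j
  · rfl
  · simp [h, h.symm, add_comm]

theorem mem_sweepIdeal {I : Ideal A} {f : A} :
    f ∈ a.sweepIdeal I ↔ ∀ m, MvPolynomial.coeff m (a.σ f) ∈ I := by
  rw [sweepIdeal, RingHom.mem_ker, MvPolynomial.ext_iff]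
  refine forall_congr' fun m => ?_
  simp [MvPolynomial.coeff_map, Ideal.Quotient.eq_zero_iff_mem]

theorem vectorField_mem_sweepIdeal {I : Ideal A} {f : A} (hf : f ∈ a.sweepIdeal I) (i : Fin r) :
    a.vectorField i f ∈ a.sweepIdeal I := by
  rw [mem_sweepIdeal] at hf ⊢
  intro m
  rw [σ_vectorField, MvPolynomial.coeff_pderiv]
  exact I.mul_mem_right _ (hf _)

theorem mem_sweepIdeal_of_vectorField_mem [Algebra ℚ A] {I : Ideal A} {f : A} (hf : f ∈ I)
    (h : ∀ i, a.vectorField i f ∈ a.sweepIdeal I) : f ∈ a.sweepIdeal I := by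
  rw [mem_sweepIdeal]
  intro m
  by_cases hm : m = 0
  · rwa [hm, ← MvPolynomial.constantCoeff_eq, a.counit]
  obtain ⟨i, hi⟩ := Finsupp.ne_iff.mp hm
  have hle : Finsupp.single i 1 ≤ m := Finsupp.single_le_iff.mpr (Nat.one_le_iff_ne_zero.mpr hi)
  have hcoeff := a.mem_sweepIdeal.mp (h i) (m - Finsupp.single i 1)
  rw [σ_vectorField, MvPolynomial.coeff_pderiv, tsub_add_cancel_of_le hle, mul_comm] at hcoeff
  have hunit : IsUnit (((m - Finsupp.single i 1 : Fin r →₀ ℕ) i : A) + 1) := by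
    rw [← Nat.cast_succ, ← map_natCast (algebraMap ℚ A)]
    exact (IsUnit.mk0 _ (Nat.cast_ne_zero.mpr (Nat.succ_ne_zero _))).map _
  exact (Ideal.unit_mul_mem_iff_mem I hunit).mp hcoeff

end VectorField

/-- The co-action is homogeneous for the grading `𝒜` when the coordinates of `𝔾ₐʳ` have degree
`w`. -/
def IsHomogeneous {r : ℕ} {A₀ A : Type u} [CommRing A₀] [CommRing A] [Algebra A₀ A]
    (a : GaCoaction r A₀ A) (w : ℕ) (𝒜 : ℕ → AddSubgroup A) : Prop :=
  ∀ n, ∀ f ∈ 𝒜 n, ∀ m : Fin r →₀ ℕ,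
    (∀ j, j + w * m.degree = n → MvPolynomial.coeff m (a.σ f) ∈ 𝒜 j) ∧
      (n < w * m.degree → MvPolynomial.coeff m (a.σ f) = 0)

/-- The ideal of the centre: the sweep of the zero section. -/
def centreIdeal {r : ℕ} {A₀ A : Type u} [CommRing A₀] [CommRing A] [Algebra A₀ A]
    (a : GaCoaction r A₀ A) (𝒜 : ℕ → AddSubgroup A) [GradedRing 𝒜] : Ideal A :=
  a.sweepIdeal (irrelevant 𝒜).toIdeal

section Homogeneous

variable {r w : ℕ} {A₀ A : Type u} [CommRing A₀] [CommRing A] [Algebra A₀ A]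
  {a : GaCoaction r A₀ A} {𝒜 : ℕ → AddSubgroup A}

theorem IsHomogeneous.vectorField_mem (h : a.IsHomogeneous w 𝒜) {n j : ℕ} {f : A} (hf : f ∈ 𝒜 n)
    (hj : j + w = n) (i : Fin r) : a.vectorField i f ∈ 𝒜 j := by
  rw [vectorField_eq_coeff]
  exact (h n f hf _).1 j (by simpa using hj)

theorem IsHomogeneous.vectorField_eq_zero (h : a.IsHomogeneous w 𝒜) {n : ℕ} {f : A}
    (hf : f ∈ 𝒜 n) (hn : n < w) (i : Fin r) : a.vectorField i f = 0 := by
  rw [vectorField_eq_coeff]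
  exact (h n f hf _).2 (by simpa using hn)

variable [GradedRing 𝒜]

theorem eq_zero_of_mem_irrelevant {f : A} (hf : f ∈ 𝒜 0) (hf' : f ∈ (irrelevant 𝒜).toIdeal) :
    f = 0 := by
  have := (mem_irrelevant_iff 𝒜 f).mp hf'
  rwa [GradedRing.proj_apply, DirectSum.decompose_of_mem_same _ hf] at this

theorem centreIdeal_le_irrelevant : a.centreIdeal 𝒜 ≤ (irrelevant 𝒜).toIdeal := fun f hf => by
  simpa [← MvPolynomial.constantCoeff_eq, a.counit] using a.mem_sweepIdeal.mp hf 0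

theorem sub_projZeroRingHom_mem_irrelevant (f : A) :
    f - GradedRing.projZeroRingHom 𝒜 f ∈ (irrelevant 𝒜).toIdeal := by
  refine (mem_irrelevant_iff 𝒜 _).mpr ?_
  rw [map_sub, GradedRing.proj_apply, GradedRing.proj_apply, GradedRing.projZeroRingHom_apply,
    DirectSum.decompose_of_mem_same 𝒜 (SetLike.coe_mem _), sub_self]

theorem IsHomogeneous.coeff_mem_irrelevant (h : a.IsHomogeneous w 𝒜) {n : ℕ} {f : A}
    (hf : f ∈ 𝒜 n) {m : Fin r →₀ ℕ} (hm : n ≠ w * m.degree) :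
    MvPolynomial.coeff m (a.σ f) ∈ (irrelevant 𝒜).toIdeal := by
  rcases lt_or_gt_of_ne hm with hlt | hlt
  · rw [(h n f hf m).2 hlt]; exact Ideal.zero_mem _
  · exact mem_irrelevant_of_mem 𝒜 (i := n - w * m.degree) (by omega)
      ((h n f hf m).1 _ (by omega))

theorem IsHomogeneous.coeff_sub_decompose_mem_irrelevant (h : a.IsHomogeneous w 𝒜) (f : A)
    (m : Fin r →₀ ℕ) :
    MvPolynomial.coeff m (a.σ (f - DirectSum.decompose 𝒜 f (w * m.degree))) ∈
      (irrelevant 𝒜).toIdeal := by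
  induction f using DirectSum.Decomposition.inductionOn 𝒜 with
  | zero => simp
  | @homogeneous n f =>
    obtain rfl | hn := eq_or_ne n (w * m.degree)
    · rw [DirectSum.decompose_of_mem_same 𝒜 f.2, sub_self]; simp
    · rw [DirectSum.decompose_of_mem_ne 𝒜 f.2 hn, sub_zero]
      exact h.coeff_mem_irrelevant f.2 hn
  | add f g hf hg =>
    simpa [DirectSum.decompose_add, add_sub_add_comm] using Ideal.add_mem _ hf hg

theorem IsHomogeneous.centreIdeal_isHomogeneous (h : a.IsHomogeneous w 𝒜) :
    (a.centreIdeal 𝒜).IsHomogeneous 𝒜 := by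
  intro n f hf
  refine a.mem_sweepIdeal.mpr fun m => ?_
  obtain rfl | hn := eq_or_ne n (w * m.degree)
  · have := sub_mem (a.mem_sweepIdeal.mp hf m) (h.coeff_sub_decompose_mem_irrelevant f m)
    simpa using this
  · exact h.coeff_mem_irrelevant (SetLike.coe_mem _) hn

end Homogeneous

section Slice

variable {r w : ℕ} {A₀ A : Type u} [CommRing A₀] [CommRing A] [Algebra A₀ A]
  {a : GaCoaction r A₀ A} {𝒜 : ℕ → AddSubgroup A} {ι : Type*} {c : ι → Fin r} {s : ι → A}

/-- Functions `s j` of degree `w` dual to the vector fields `ξ_{c i}`: their common zero locus is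
a slice for the action of the subgroup of `𝔾ₐʳ` with coordinates `c`. -/
structure IsSlice [DecidableEq ι] (a : GaCoaction r A₀ A) (w : ℕ) (𝒜 : ℕ → AddSubgroup A)
    (c : ι → Fin r) (s : ι → A) : Prop where
  mem : ∀ j, s j ∈ 𝒜 w
  vectorField_apply : ∀ i j, a.vectorField (c i) (s j) = if i = j then 1 else 0

variable [Fintype ι]

/-- The vector field `ξᵢ`, corrected by a combination of the `ξ_{c j}` so as to annihilate the
functions `s j` of a slice. -/
def transverse (a : GaCoaction r A₀ A) (c : ι → Fin r) (s : ι → A) (i : Fin r) :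
    Derivation A₀ A A :=
  a.vectorField i - ∑ j, a.vectorField i (s j) • a.vectorField (c j)

theorem transverse_apply (i : Fin r) (f : A) :
    a.transverse c s i f =
      a.vectorField i f - ∑ j, a.vectorField i (s j) * a.vectorField (c j) f := by
  have h := congrFun (map_sum (Derivation.coeFnAddMonoidHom (R := A₀) (A := A) (M := A))
    (fun j => a.vectorField i (s j) • a.vectorField (c j)) Finset.univ) f
  rw [Finset.sum_apply] at h
  rw [transverse, Derivation.sub_apply]
  exact congrArg _ h

theorem IsSlice.transverse_slice [DecidableEq ι] (hs : a.IsSlice w 𝒜 c s) (i : Fin r) (j : ι) :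
    a.transverse c s i (s j) = 0 := by
  simp [transverse_apply, hs.vectorField_apply]

theorem transverse_mem_centreIdeal_of_mem [GradedRing 𝒜] (i : Fin r) {f : A}
    (hf : f ∈ a.centreIdeal 𝒜) : a.transverse c s i f ∈ a.centreIdeal 𝒜 := by
  rw [transverse_apply]
  exact sub_mem (a.vectorField_mem_sweepIdeal hf i)
    (sum_mem fun j _ => Ideal.mul_mem_left _ _ (a.vectorField_mem_sweepIdeal hf _))

theorem IsHomogeneous.transverse_mem [GradedRing 𝒜] (h : a.IsHomogeneous w 𝒜)
    (hs : ∀ j, s j ∈ 𝒜 w) {n j : ℕ} {f : A} (hf : f ∈ 𝒜 n) (hj : j + w = n) (i : Fin r) :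
    a.transverse c s i f ∈ 𝒜 j := by
  rw [transverse_apply]
  refine sub_mem (h.vectorField_mem hf hj i) (sum_mem fun l _ => ?_)
  simpa using SetLike.mul_mem_graded (h.vectorField_mem (hs l) (zero_add w) i)
    (h.vectorField_mem hf hj (c l))

theorem IsHomogeneous.transverse_eq_zero (h : a.IsHomogeneous w 𝒜) {n : ℕ} {f : A}
    (hf : f ∈ 𝒜 n) (hn : n < w) (i : Fin r) : a.transverse c s i f = 0 := by
  simp [transverse_apply, h.vectorField_eq_zero hf hn]

theorem IsHomogeneous.vectorField_transverse (h : a.IsHomogeneous w 𝒜) (hw : 0 < w)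
    (hs : ∀ j, s j ∈ 𝒜 w) (i j : Fin r) (f : A) :
    a.vectorField j (a.transverse c s i f) = a.transverse c s i (a.vectorField j f) := by
  have hconst : ∀ l, a.vectorField j (a.vectorField i (s l)) = 0 := fun l =>
    h.vectorField_eq_zero (h.vectorField_mem (hs l) (zero_add w) i) hw j
  simp [transverse_apply, Derivation.leibniz, hconst, a.vectorField_comm j]

/-! ### The projection to the sweep of the zero section -/

/-- The co-morphism of `x ↦ (∑ j, s j (x) ξ_{c j}).z` with `z` the image of `x` in the zero
section. For a slice that meets all orbits of the zero section this is a retraction onto the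
sweep of the zero section. -/
def retraction (a : GaCoaction r A₀ A) (𝒜 : ℕ → AddSubgroup A) [GradedRing 𝒜] [DecidableEq ι]
    (c : ι → Fin r) (s : ι → A) : A →+* A :=
  (MvPolynomial.eval₂Hom (GradedRing.projZeroRingHom 𝒜)
    fun i => ∑ j, if c j = i then s j else 0).comp a.σ.toRingHom

theorem derivation_eval₂ {κ R : Type*} [CommRing R] [Fintype κ] (D : Derivation A₀ A A)
    (g : R →+* A) (hg : ∀ x, D (g x) = 0) (t : κ → A) (P : MvPolynomial κ R) :
    D (P.eval₂ g t) = ∑ i, (MvPolynomial.pderiv i P).eval₂ g t * D (t i) := by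
  classical
  induction P using MvPolynomial.induction_on with
  | C x => simp [hg]
  | add P Q hP hQ => simp [hP, hQ, add_mul, Finset.sum_add_distrib]
  | mul_X P j hP =>
    have hX (i : κ) : (Pi.single (M := fun _ => MvPolynomial κ R) i 1 j).eval₂ g t =
        if i = j then 1 else 0 := by
      obtain rfl | h := eq_or_ne i j
      · simp
      · simp [h]
    simp [Derivation.leibniz, MvPolynomial.pderiv_X, hX, hP, add_mul, Finset.sum_add_distrib,
      Finset.mul_sum, mul_assoc]

variable [DecidableEq ι] [GradedRing 𝒜]

theorem derivation_retraction (D : Derivation A₀ A A) (hD : ∀ f ∈ 𝒜 0, D f = 0) (f : A) :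
    D (a.retraction 𝒜 c s f) =
      ∑ i, a.retraction 𝒜 c s (a.vectorField i f) * ∑ j, if c j = i then D (s j) else 0 := by
  refine (derivation_eval₂ D _ (fun x => hD _ (SetLike.coe_mem _)) _ _).trans
    (Finset.sum_congr rfl fun i _ => ?_)
  rw [map_sum]
  congr 1
  · exact congrArg _ (a.σ_vectorField i f).symm
  · exact Finset.sum_congr rfl fun j _ => by split_ifs <;> simp

theorem IsSlice.vectorField_retraction (hs : a.IsSlice w 𝒜 c s) (h : a.IsHomogeneous w 𝒜)
    (hw : 0 < w) (l : ι) (f : A) :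
    a.vectorField (c l) (a.retraction 𝒜 c s f) =
      a.retraction 𝒜 c s (a.vectorField (c l) f) := by
  rw [derivation_retraction _ fun f hf => h.vectorField_eq_zero hf hw _]
  have hsum (i : Fin r) : (∑ j, if c j = i then a.vectorField (c l) (s j) else 0) =
      if c l = i then 1 else 0 := by
    simp only [hs.vectorField_apply]
    rw [Finset.sum_eq_single l] <;> simp +contextual [eq_comm]
  simp [hsum]

theorem IsSlice.transverse_retraction (hs : a.IsSlice w 𝒜 c s) (h : a.IsHomogeneous w 𝒜)
    (hw : 0 < w) (i : Fin r) (f : A) : a.transverse c s i (a.retraction 𝒜 c s f) = 0 := by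
  rw [derivation_retraction _ fun f hf => h.transverse_eq_zero hf hw _]
  simp [hs.transverse_slice]

theorem sub_retraction_mem_irrelevant (hw : 0 < w) (hs : ∀ j, s j ∈ 𝒜 w) (f : A) :
    f - a.retraction 𝒜 c s f ∈ (irrelevant 𝒜).toIdeal := by
  have hzero (i : Fin r) : Ideal.Quotient.mk (irrelevant 𝒜).toIdeal
      (∑ j, if c j = i then s j else 0) = 0 :=
    Ideal.Quotient.eq_zero_iff_mem.mpr <| sum_mem fun j _ => by
      split_ifs
      · exact mem_irrelevant_of_mem 𝒜 hw (hs j)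
      · exact Ideal.zero_mem _
  have hconst : Ideal.Quotient.mk (irrelevant 𝒜).toIdeal (a.retraction 𝒜 c s f) =
      Ideal.Quotient.mk _ (GradedRing.projZeroRingHom 𝒜 f) := by
    change Ideal.Quotient.mk _ (MvPolynomial.eval₂ _ _ (a.σ f)) = _
    rw [MvPolynomial.hom_eval₂]
    simp only [hzero, MvPolynomial.eval₂_zero'_apply, RingHom.comp_apply,
      a.counit]
  rw [← Ideal.Quotient.eq, hconst]
  exact Ideal.Quotient.eq.mpr (sub_projZeroRingHom_mem_irrelevant f)

/-! ### Transverse fields and the centre -/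

variable [Algebra ℚ A]

omit [DecidableEq ι] in
theorem IsHomogeneous.transverse_mem_centreIdeal (h : a.IsHomogeneous w 𝒜) (hw : 0 < w)
    (hs : ∀ j, s j ∈ 𝒜 w) (hρ : ∀ f ∈ 𝒜 w, ∀ i, a.transverse c s i f = 0) (i : Fin r) (f : A) :
    a.transverse c s i f ∈ a.centreIdeal 𝒜 := by
  have key : ∀ n, ∀ f ∈ 𝒜 n, a.transverse c s i f ∈ a.centreIdeal 𝒜 := by
    intro n
    induction n using Nat.strong_induction_on with
    | _ n ih =>
      intro f hf
      rcases lt_trichotomy n w with hlt | rfl | hlt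
      · rw [h.transverse_eq_zero hf hlt]; exact Ideal.zero_mem _
      · rw [hρ f hf]; exact Ideal.zero_mem _
      · refine a.mem_sweepIdeal_of_vectorField_mem (mem_irrelevant_of_mem 𝒜 (i := n - w) (by omega)
          (h.transverse_mem hs hf (by omega) i)) fun j => ?_
        rw [h.vectorField_transverse hw hs]
        exact ih (n - w) (by omega) _ (h.vectorField_mem hf (by omega) j)
  induction f using DirectSum.Decomposition.inductionOn 𝒜 with
  | zero => simp
  | homogeneous f => exact key _ f f.2
  | add f g hf hg => rw [map_add]; exact add_mem hf hg

omit [DecidableEq ι] in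
theorem IsHomogeneous.mem_centreIdeal_of_vectorField_mem (h : a.IsHomogeneous w 𝒜) (hw : 0 < w)
    (hs : ∀ j, s j ∈ 𝒜 w) (hρ : ∀ f ∈ 𝒜 w, ∀ i, a.transverse c s i f = 0) {f : A}
    (hf : f ∈ (irrelevant 𝒜).toIdeal) (hc : ∀ j, a.vectorField (c j) f ∈ a.centreIdeal 𝒜) :
    f ∈ a.centreIdeal 𝒜 := by
  refine a.mem_sweepIdeal_of_vectorField_mem hf fun i => ?_
  have hdecomp : a.vectorField i f =
      a.transverse c s i f + ∑ j, a.vectorField i (s j) * a.vectorField (c j) f := by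
    rw [transverse_apply, sub_add_cancel]
  rw [hdecomp]
  exact add_mem (h.transverse_mem_centreIdeal hw hs hρ i f)
    (sum_mem fun j _ => Ideal.mul_mem_left _ _ (hc j))

theorem IsSlice.sub_retraction_mem_centreIdeal (hs : a.IsSlice w 𝒜 c s)
    (h : a.IsHomogeneous w 𝒜) (hw : 0 < w) (hρ : ∀ f ∈ 𝒜 w, ∀ i, a.transverse c s i f = 0)
    (f : A) : f - a.retraction 𝒜 c s f ∈ a.centreIdeal 𝒜 := by
  have key : ∀ n, ∀ f ∈ 𝒜 n, f - a.retraction 𝒜 c s f ∈ a.centreIdeal 𝒜 := by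
    intro n
    induction n using Nat.strong_induction_on with
    | _ n ih =>
      intro f hf
      refine h.mem_centreIdeal_of_vectorField_mem hw hs.mem hρ
        (sub_retraction_mem_irrelevant hw hs.mem f) fun l => ?_
      rw [map_sub, hs.vectorField_retraction h hw]
      rcases lt_or_ge n w with hlt | hge
      · simp [h.vectorField_eq_zero hf hlt]
      · exact ih (n - w) (by omega) _ (h.vectorField_mem hf (by omega) _)
  induction f using DirectSum.Decomposition.inductionOn 𝒜 with
  | zero => simp
  | homogeneous f => exact key _ f f.2
  | add f g hf hg => rw [map_add, add_sub_add_comm]; exact add_mem hf hg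

end Slice

end GaCoaction

theorem det_mul_eq_zero_of_card_lt {R ι κ : Type*} [CommRing R] [Fintype ι] [Fintype κ]
    [DecidableEq κ] (h : Fintype.card ι < Fintype.card κ) (B : Matrix κ ι R)
    (S : Matrix ι κ R) : (B * S).det = 0 := by
  classical
  obtain ⟨n, hn⟩ := Nat.exists_eq_add_of_lt h
  let e : κ ≃ ι ⊕ Fin (n + 1) := Fintype.equivOfCardEq (by simp [hn, add_assoc])
  have hBS : B * S = (Matrix.fromCols B (0 : Matrix κ (Fin (n + 1)) R)).submatrix id e *
      (Matrix.fromRows S (0 : Matrix (Fin (n + 1)) κ R)).submatrix e id := by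
    rw [Matrix.submatrix_mul_equiv, Matrix.fromCols_mul_fromRows]
    simp
  rw [hBS, Matrix.det_mul, Matrix.det_eq_zero_of_column_eq_zero (e.symm (Sum.inr 0)), zero_mul]
  simp

theorem decompose_eq_zero_of_mem_span_of_lt {A : Type*} [CommRing A] {𝒜 : ℕ → AddSubgroup A}
    [GradedRing 𝒜] {e : ℕ} {y : A} (hy : y ∈ Ideal.span {f | ∃ n > e, f ∈ 𝒜 n}) :
    (DirectSum.decompose 𝒜 y e : A) = 0 := by
  induction hy using Submodule.closure_induction with
  | zero => simp
  | add x y _ _ hx hy => simp [DirectSum.decompose_add, hx, hy]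
  | smul_mem b x hx =>
    obtain ⟨n, hn, hx⟩ := hx
    exact DirectSum.coe_decompose_mul_of_right_mem_of_not_le 𝒜 hx (by omega)

namespace GaCoaction

/-- The Fitting ideals of `Q`. -/
def fit {r : ℕ} {A₀ A : Type u} [CommRing A₀] [CommRing A] [Algebra A₀ A]
    (a : GaCoaction r A₀ A) (j : ℤ) : Ideal A :=
  fittingIdeal (M := a.Q) (Submodule.mkQ _) j

section Fitting

variable {r w : ℕ} {A₀ A : Type u} [CommRing A₀] [CommRing A] [Algebra A₀ A]
  {a : GaCoaction r A₀ A}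

theorem ker_mkQ_range_conormalMap (a : GaCoaction r A₀ A) :
    LinearMap.ker (LinearMap.range a.conormalMap).mkQ =
      Submodule.span A (Set.range a.vectorFields) := by
  rw [Submodule.ker_mkQ, LinearMap.range_eq_map, ← KaehlerDifferential.span_range_derivation,
    Submodule.map_span, ← Set.range_comp]
  congr 1
  ext f
  simp [conormalMap, Derivation.liftKaehlerDifferential_comp_D]

theorem det_vectorField_mem_fit (a : GaCoaction r A₀ A) {κ : Type*} [Fintype κ] [DecidableEq κ]
    {j : ℤ} (hj : (r - j).toNat = Fintype.card κ) (f : κ → A) (c : κ → Fin r) :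
    (Matrix.of fun s t => a.vectorField (c t) (f s)).det ∈ a.fit j := by
  let e : Fin (r - j).toNat ≃ κ := (finCongr hj).trans (Fintype.equivFin κ).symm
  refine Ideal.subset_span ⟨fun s => ⟨a.vectorFields (f (e s)), ?_⟩, fun t => c (e t), ?_⟩
  · rw [ker_mkQ_range_conormalMap]
    exact Submodule.subset_span ⟨_, rfl⟩
  · rw [← Matrix.det_submatrix_equiv_self e]
    rfl

section Slice

variable {𝒜 : ℕ → AddSubgroup A} {ι : Type*} [Fintype ι] {c : ι → Fin r} {s : ι → A}

theorem IsSlice.det_eq_transverse [DecidableEq ι] (hs : a.IsSlice w 𝒜 c s) (i : Fin r) (f : A) :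
    (Matrix.of fun x t : ι ⊕ Unit =>
      a.vectorField (Sum.elim c (fun _ => i) t) (Sum.elim s (fun _ => f) x)).det =
      a.transverse c s i f := by
  have hblocks : (Matrix.of fun x t : ι ⊕ Unit =>
      a.vectorField (Sum.elim c (fun _ => i) t) (Sum.elim s (fun _ => f) x)) =
      Matrix.fromBlocks 1 (Matrix.of fun x _ => a.vectorField i (s x))
        (Matrix.of fun _ t => a.vectorField (c t) f) (Matrix.of fun _ _ => a.vectorField i f) := by
    ext (x | _) (t | _)
    · simp [hs.vectorField_apply, Matrix.one_apply, eq_comm]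
    all_goals simp
  rw [hblocks, Matrix.det_fromBlocks_one₁₁, Matrix.det_unique]
  simp [transverse_apply, Matrix.mul_apply, mul_comm]

theorem IsSlice.transverse_mem_fit [DecidableEq ι] (hs : a.IsSlice w 𝒜 c s) {j : ℤ}
    (hj : (r - j).toNat = Fintype.card ι + 1) (i : Fin r) (f : A) :
    a.transverse c s i f ∈ a.fit j := by
  rw [← hs.det_eq_transverse]
  exact a.det_vectorField_mem_fit (by simpa using hj) _ _

theorem fit_le_of_transverse_mem {I : Ideal A} (hI : ∀ i f, a.transverse c s i f ∈ I) {j : ℤ}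
    (hj : Fintype.card ι < (r - j).toNat) : a.fit j ≤ I := by
  have hrel : ∀ y ∈ LinearMap.ker (LinearMap.range a.conormalMap).mkQ, ∀ t,
      y t - ∑ l, y (c l) * a.vectorField t (s l) ∈ I := by
    intro y hy t
    rw [ker_mkQ_range_conormalMap] at hy
    induction hy using Submodule.span_induction with
    | mem x hx =>
      obtain ⟨f, rfl⟩ := hx
      simpa [transverse_apply, vectorFields_apply, mul_comm] using hI t f
    | zero => simp
    | add x y _ _ hx hy =>
      simpa [add_mul, Finset.sum_add_distrib, add_sub_add_comm] using I.add_mem hx hy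
    | smul b x _ hx => simpa [mul_sub, Finset.mul_sum, mul_assoc] using I.mul_mem_left b hx
  refine Ideal.span_le.mpr ?_
  rintro _ ⟨rel, col, rfl⟩
  rw [SetLike.mem_coe, ← Ideal.Quotient.eq_zero_iff_mem, RingHom.map_det]
  have hfactor : (Ideal.Quotient.mk I).mapMatrix
      (Matrix.of fun s t => (rel s : Fin r → A) (col t)) =
      (Matrix.of fun n l => Ideal.Quotient.mk I ((rel n : Fin r → A) (c l))) *
      (Matrix.of fun l n => Ideal.Quotient.mk I (a.vectorField (col n) (s l))) := by
    ext n t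
    simpa [Matrix.mul_apply] using Ideal.Quotient.eq.mpr (hrel _ (rel n).2 (col t))
  rw [hfactor]
  exact det_mul_eq_zero_of_card_lt (by simpa using hj) _ _

theorem IsSlice.exists_transverse_ne_zero [DecidableEq ι] [Algebra ℚ A] [GradedRing 𝒜]
    (hs : a.IsSlice w 𝒜 c s) (h : a.IsHomogeneous w 𝒜) (hw : 0 < w)
    (hρ : ∀ f ∈ 𝒜 w, ∀ i, a.transverse c s i f = 0) {j : ℤ}
    (hj : Fintype.card ι < (r - j).toNat) {e : ℕ} {x : A} (hx : x ∈ a.fit j) (hxe : x ∈ 𝒜 e)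
    (hx0 : x ≠ 0) :
    ∃ n ≤ e, ∃ f ∈ 𝒜 (n + w), f ∈ a.centreIdeal 𝒜 ∧ ∃ i, a.transverse c s i f ≠ 0 := by
  classical
  by_contra! hzero
  have hcentre : ∀ f ∈ a.centreIdeal 𝒜, ∀ i,
      a.transverse c s i f ∈ Ideal.span {y | ∃ n > e, y ∈ 𝒜 n} := by
    intro f hf i
    rw [← DirectSum.sum_support_decompose 𝒜 f, map_sum]
    refine sum_mem fun l _ => ?_
    have hfl := h.centreIdeal_isHomogeneous l hf
    rcases lt_or_ge l w with hlt | hge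
    · simp [h.transverse_eq_zero (SetLike.coe_mem _) hlt]
    obtain ⟨n, rfl⟩ := Nat.exists_eq_add_of_le' hge
    rcases le_or_gt n e with hle | hgt
    · simp [hzero n hle _ (SetLike.coe_mem _) hfl]
    · exact Ideal.subset_span ⟨n, hgt, h.transverse_mem hs.mem (SetLike.coe_mem _) rfl i⟩
  have hall : ∀ i f, a.transverse c s i f ∈ Ideal.span {y | ∃ n > e, y ∈ 𝒜 n} := fun i f => by
    simpa [hs.transverse_retraction h hw] using
      hcentre _ (hs.sub_retraction_mem_centreIdeal h hw hρ f) i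
  refine hx0 ?_
  rw [← DirectSum.decompose_of_mem_same 𝒜 hxe]
  exact decompose_eq_zero_of_mem_span_of_lt (fit_le_of_transverse_mem hall hj hx)

end Slice

/-! ### Equivariant homomorphisms -/

section Equivariant

open HomogeneousIdeal

variable {A₀' A' : Type u} [CommRing A₀'] [CommRing A'] [Algebra A₀' A']
  {a' : GaCoaction r A₀' A'} {φ : A →+* A'} (hσ : ∀ f, a'.σ (φ f) = MvPolynomial.map φ (a.σ f))

include hσ

theorem vectorField_map (i : Fin r) (f : A) : a'.vectorField i (φ f) = φ (a.vectorField i f) := by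
  rw [vectorField_eq_coeff, vectorField_eq_coeff, hσ, MvPolynomial.coeff_map]

theorem map_mem_fit {j : ℤ} {x : A} (hx : x ∈ a.fit j) : φ x ∈ a'.fit j := by
  have hrel : ∀ y ∈ LinearMap.ker (LinearMap.range a.conormalMap).mkQ,
      (fun i => φ (y i)) ∈ LinearMap.ker (LinearMap.range a'.conormalMap).mkQ := by
    intro y hy
    rw [ker_mkQ_range_conormalMap] at hy ⊢
    induction hy using Submodule.span_induction with
    | mem x hx =>
      obtain ⟨f, rfl⟩ := hx
      exact Submodule.subset_span ⟨φ f, funext fun i => vectorField_map hσ i f⟩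
    | zero => simp [← Pi.zero_def]
    | add x y _ _ hx hy => simpa [Pi.add_def] using Submodule.add_mem _ hx hy
    | smul b x _ hx => simpa [Pi.smul_def] using Submodule.smul_mem _ (φ b) hx
  suffices a.fit j ≤ (a'.fit j).comap φ from this hx
  refine Ideal.span_le.mpr ?_
  rintro _ ⟨rel, col, rfl⟩
  refine Ideal.subset_span ⟨fun s => ⟨_, hrel _ (rel s).2⟩, col, ?_⟩
  rw [RingHom.map_det]
  rfl

theorem transverse_map {ι : Type*} [Fintype ι] (c : ι → Fin r) (s : ι → A) (i : Fin r) (f : A) :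
    a'.transverse c (φ ∘ s) i (φ f) = φ (a.transverse c s i f) := by
  simp [transverse_apply, vectorField_map hσ]

theorem IsSlice.map {𝒜 : ℕ → AddSubgroup A} {𝒜' : ℕ → AddSubgroup A'}
    {ι : Type*} [DecidableEq ι] {c : ι → Fin r} {s : ι → A}
    (hs : a.IsSlice w 𝒜 c s) (hmem : ∀ f ∈ 𝒜 w, φ f ∈ 𝒜' w) : a'.IsSlice w 𝒜' c (φ ∘ s) where
  mem j := hmem _ (hs.mem j)
  vectorField_apply i j := by
    rw [Function.comp_apply, vectorField_map hσ, hs.vectorField_apply]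
    split_ifs <;> simp

end Equivariant

end Fitting

end GaCoaction

/-! ### Principal ideals near the irrelevant ideal -/

theorem exists_span_singleton_eq_of_span_eq {O : Type*} [CommRing O] [IsDomain O] [IsLocalRing O]
    {T : Set O} {γ : O} (hγ : γ ≠ 0) (hT : Ideal.span T = Ideal.span {γ}) :
    ∃ t ∈ T, Ideal.span {t} = Ideal.span {γ} := by
  by_contra! hne
  have hle : Ideal.span T ≤ IsLocalRing.maximalIdeal O * Ideal.span {γ} := by
    refine Ideal.span_le.mpr fun t ht => ?_
    obtain ⟨b, rfl⟩ := Ideal.mem_span_singleton'.mp (hT ▸ Ideal.subset_span ht : t ∈ Ideal.span {γ})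
    refine Ideal.mul_mem_mul ((IsLocalRing.mem_maximalIdeal b).mpr fun hb => ?_)
      (Ideal.mem_span_singleton_self γ)
    exact hne _ ht (Ideal.span_singleton_mul_left_unit hb γ)
  obtain ⟨b, hb, hbγ⟩ :=
    Ideal.mem_mul_span_singleton.mp (hle (hT ▸ Ideal.mem_span_singleton_self γ))
  have hb1 : b = 1 := mul_right_cancel₀ hγ (by rw [hbγ, one_mul])
  exact (IsLocalRing.mem_maximalIdeal b).mp hb (hb1 ▸ isUnit_one)

theorem exists_forall_mul_eq_mul_of_map_eq_span_singleton {A O : Type*} [CommRing A] [CommRing O]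
    [IsDomain O] [Algebra A O] (P : Ideal A) [P.IsPrime] [IsLocalization.AtPrime O P]
    {T : Set A} {γ : O} (hγ : γ ≠ 0)
    (hT : (Ideal.span T).map (algebraMap A O) = Ideal.span {γ}) :
    ∃ g ∈ T, g ≠ 0 ∧ ∀ x ∈ Ideal.span T, ∃ b ∉ P, ∃ t, b * x = t * g := by
  have : IsLocalRing O := IsLocalization.AtPrime.isLocalRing O P
  obtain ⟨_, ⟨g, hg, rfl⟩, hgγ⟩ :=
    exists_span_singleton_eq_of_span_eq hγ ((Ideal.map_span _ T).symm.trans hT)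
  refine ⟨g, hg, ?_, fun x hx => ?_⟩
  · rintro rfl
    rw [map_zero, Ideal.span_singleton_zero, eq_comm, Ideal.span_singleton_eq_bot] at hgγ
    exact hγ hgγ
  have hxg : algebraMap A O x ∈ Ideal.span {algebraMap A O g} := by
    rw [hgγ, ← hT]
    exact Ideal.mem_map_of_mem _ hx
  obtain ⟨o, ho⟩ := Ideal.mem_span_singleton'.mp hxg
  obtain ⟨t, b, rfl⟩ := IsLocalization.exists_mk'_eq P.primeCompl o
  obtain ⟨u, hu⟩ := IsLocalization.exists_of_eq (S := O) (M := P.primeCompl) (x := b * x)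
    (y := t * g) <| by
    rw [map_mul, map_mul, ← ho, ← mul_assoc, IsLocalization.mk'_spec']
  exact ⟨u * b, (u * b).2, u * t, by rw [mul_assoc, hu, mul_assoc]⟩

section Graded

open HomogeneousIdeal

variable {A : Type*} [CommRing A] [IsDomain A] (𝒜 : ℕ → AddSubgroup A) [GradedRing 𝒜]

theorem isPrime_irrelevant : (irrelevant 𝒜).toIdeal.IsPrime := by
  have hker : (irrelevant 𝒜).toIdeal = RingHom.ker (GradedRing.projZeroRingHom 𝒜) := by
    ext x
    exact mem_irrelevant_iff 𝒜 x
  exact hker ▸ RingHom.ker_isPrime _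

theorem exists_homogeneous_mul_eq {b t x g : A} {n δ : ℕ} (hb : b ∉ (irrelevant 𝒜).toIdeal)
    (hx : x ∈ 𝒜 n) (hx0 : x ≠ 0) (hg : g ∈ 𝒜 δ) (h : b * x = t * g) :
    δ ≤ n ∧ ∃ b₀ ∈ 𝒜 0, b₀ ≠ 0 ∧ ∃ t₀ ∈ 𝒜 (n - δ), b₀ * x = t₀ * g := by
  have hb0 : (DirectSum.decompose 𝒜 b 0 : A) ≠ 0 := fun h0 => hb ((mem_irrelevant_iff 𝒜 b).mpr h0)
  have hdeg : (DirectSum.decompose 𝒜 b 0 : A) * x = DirectSum.decompose 𝒜 (t * g) n := by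
    rw [← h, DirectSum.coe_decompose_mul_of_right_mem_of_le 𝒜 hx le_rfl, Nat.sub_self]
  have hle : δ ≤ n := by
    by_contra hlt
    rw [DirectSum.coe_decompose_mul_of_right_mem_of_not_le 𝒜 hg hlt] at hdeg
    exact mul_ne_zero hb0 hx0 hdeg
  rw [DirectSum.coe_decompose_mul_of_right_mem_of_le 𝒜 hg hle] at hdeg
  exact ⟨hle, _, SetLike.coe_mem _, hb0, _, SetLike.coe_mem _, hdeg⟩

theorem exists_homogeneous_forall_mul_eq_mul {O : Type*} [CommRing O] [IsDomain O] [Algebra A O]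
    [(irrelevant 𝒜).toIdeal.IsPrime] [IsLocalization.AtPrime O (irrelevant 𝒜).toIdeal]
    {T : Set A} (hT : ∀ t ∈ T, SetLike.IsHomogeneousElem 𝒜 t) {γ : O} (hγ : γ ≠ 0)
    (hmap : (Ideal.span T).map (algebraMap A O) = Ideal.span {γ}) :
    ∃ δ, ∃ g ∈ T, g ∈ 𝒜 δ ∧ g ≠ 0 ∧ ∀ n, ∀ x ∈ 𝒜 n, x ∈ Ideal.span T → x ≠ 0 →
      δ ≤ n ∧ ∃ b ∈ 𝒜 0, b ≠ 0 ∧ ∃ t ∈ 𝒜 (n - δ), b * x = t * g := by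
  obtain ⟨g, hgT, hg0, hdvd⟩ :=
    exists_forall_mul_eq_mul_of_map_eq_span_singleton (irrelevant 𝒜).toIdeal hγ hmap
  obtain ⟨δ, hg⟩ := hT g hgT
  refine ⟨δ, g, hgT, hg, hg0, fun n x hx hxT hx0 => ?_⟩
  obtain ⟨b, hb, t, hbt⟩ := hdvd x hxT
  exact exists_homogeneous_mul_eq 𝒜 hb hx hx0 hg hbt

end Graded

namespace GaCoaction

open HomogeneousIdeal

variable {r w : ℕ} {A₀ A A₀' A' : Type u} [CommRing A₀] [CommRing A] [Algebra A₀ A]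
  [CommRing A₀'] [CommRing A'] [IsDomain A'] [Algebra A₀' A']
  {a : GaCoaction r A₀ A} {a' : GaCoaction r A₀' A'}
  {𝒜 : ℕ → AddSubgroup A} {𝒜' : ℕ → AddSubgroup A'} [GradedRing 𝒜] [GradedRing 𝒜']
  {φ : A →+* A'} {O : Type*} [CommRing O] [IsDomain O] [Algebra A' O]
  [(irrelevant 𝒜').toIdeal.IsPrime] [IsLocalization.AtPrime O (irrelevant 𝒜').toIdeal]

theorem IsHomogeneous.exists_centreIdeal_divisor (h : a.IsHomogeneous w 𝒜)
    (hφ : ∀ n, ∀ f ∈ 𝒜 n, φ f ∈ 𝒜' n) (hinj : Function.Injective φ) {γ : O} (hγ : γ ≠ 0)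
    (hJ : (a.centreIdeal 𝒜).map ((algebraMap A' O).comp φ) = Ideal.span {γ}) :
    ∃ δ, ∃ g ∈ 𝒜 δ, g ∈ a.centreIdeal 𝒜 ∧ g ≠ 0 ∧
      ∀ n, ∀ x ∈ 𝒜 n, x ∈ a.centreIdeal 𝒜 → x ≠ 0 →
        δ ≤ n ∧ ∃ b ∈ 𝒜' 0, b ≠ 0 ∧ ∃ t ∈ 𝒜' (n - δ), b * φ x = t * φ g := by
  obtain ⟨S, hS⟩ := (Ideal.IsHomogeneous.iff_exists 𝒜 _).mp h.centreIdeal_isHomogeneous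
  have hmap : (a.centreIdeal 𝒜).map φ = Ideal.span (φ '' ((↑) '' S)) := by rw [hS, Ideal.map_span]
  have hhom : ∀ t ∈ φ '' ((↑) '' S), SetLike.IsHomogeneousElem 𝒜' t := by
    rintro _ ⟨_, ⟨x, -, rfl⟩, rfl⟩
    exact x.2.imp fun n => hφ n x
  rw [← Ideal.map_map, hmap] at hJ
  obtain ⟨δ, _, ⟨_, ⟨g, hgS, rfl⟩, rfl⟩, hgδ, hg0, hdvd⟩ :=
    exists_homogeneous_forall_mul_eq_mul 𝒜' hhom hγ hJ
  obtain ⟨n, hgn⟩ := g.2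
  have hδ : n = δ := DirectSum.degree_eq_of_mem_mem 𝒜' (hφ n g hgn) hgδ hg0
  refine ⟨δ, g, hδ ▸ hgn, hS ▸ Ideal.subset_span ⟨g, hgS, rfl⟩, fun h0 => hg0 (by simp [h0]),
    fun n x hx hxJ hx0 => hdvd n _ (hφ n x hx) ?_ ((map_ne_zero_iff φ hinj).mpr hx0)⟩
  exact hmap ▸ Ideal.mem_map_of_mem φ hxJ

theorem IsSlice.exists_mem_fit_degree_lt {ι : Type*} [Fintype ι] [DecidableEq ι] {c : ι → Fin r}
    {s : ι → A} (hs : a.IsSlice w 𝒜 c s) (hw : 0 < w) (h : a.IsHomogeneous w 𝒜)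
    (h' : a'.IsHomogeneous w 𝒜') (hσ : ∀ f, a'.σ (φ f) = MvPolynomial.map φ (a.σ f))
    (hφ : ∀ n, ∀ f ∈ 𝒜 n, φ f ∈ 𝒜' n) (hinj : Function.Injective φ) {γ : O} (hγ : γ ≠ 0)
    (hJ : (a.centreIdeal 𝒜).map ((algebraMap A' O).comp φ) = Ideal.span {γ})
    {j : ℤ} (hj : (r - j).toNat = Fintype.card ι + 1) {n : ℕ} {f : A} (hf : f ∈ 𝒜 (n + w))
    (hfJ : f ∈ a.centreIdeal 𝒜) {i : Fin r} (hi : a.transverse c s i f ≠ 0) :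
    ∃ m < n, ∃ x ∈ a'.fit j, x ∈ 𝒜' m ∧ x ≠ 0 := by
  obtain ⟨δ, g, hg, hgJ, hg0, hdvd⟩ := h.exists_centreIdeal_divisor hφ hinj hγ hJ
  have hδ : 0 < δ := Nat.pos_of_ne_zero <| by
    rintro rfl
    exact hg0 (eq_zero_of_mem_irrelevant hg (centreIdeal_le_irrelevant hgJ))
  -- `g` has the smallest degree in the ideal of the centre, and `ρᵢ g` would have a smaller one.
  have hρg : a.transverse c s i g = 0 := by
    rcases lt_or_ge δ w with hlt | hge
    · exact h.transverse_eq_zero hg hlt i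
    · by_contra hne
      have := (hdvd (δ - w) _ (h.transverse_mem hs.mem hg (by omega) i)
        (transverse_mem_centreIdeal_of_mem i hgJ) hne).1
      omega
  have hf0 : f ≠ 0 := fun h0 => hi (by rw [h0, map_zero])
  obtain ⟨hle, b, hb, hb0, y, hy, hbf⟩ := hdvd _ f hf hfJ hf0
  have hρ : b * φ (a.transverse c s i f) = φ g * a'.transverse c (φ ∘ s) i y := by
    simpa [Derivation.leibniz, transverse_map hσ, h'.transverse_eq_zero hb hw, hρg] using
      congrArg (a'.transverse c (φ ∘ s) i) hbf
  have hρy : a'.transverse c (φ ∘ s) i y ≠ 0 := fun h0 => by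
    rw [h0, mul_zero] at hρ
    exact mul_ne_zero hb0 ((map_ne_zero_iff φ hinj).mpr hi) hρ
  have hwδ : w ≤ n + w - δ := by
    by_contra hlt
    exact hρy (h'.transverse_eq_zero hy (by omega) i)
  have hs' : a'.IsSlice w 𝒜' c (φ ∘ s) := hs.map hσ (hφ w)
  exact ⟨n - δ, by omega, _, hs'.transverse_mem_fit hj i y,
    h'.transverse_mem hs'.mem hy (by omega) i, hρy⟩

end GaCoaction

/-! ### Orthogonal complements and minors -/

section LinearAlgebra

variable {K n : Type*} [Field K] [Fintype n]

theorem finrank_span_add_finrank_eq_card {T : Set (n → K)} {N : Submodule K (n → K)}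
    (hN : ∀ c, c ∈ N ↔ ∀ v ∈ T, c ⬝ᵥ v = 0) :
    Module.finrank K (Submodule.span K T) + Module.finrank K N = Fintype.card n := by
  classical
  have hmap : N.map (dotProductEquiv K n).toLinearMap = (Submodule.span K T).dualAnnihilator := by
    ext ψ
    obtain ⟨c, rfl⟩ := (dotProductEquiv K n).surjective ψ
    have hspan := Submodule.span_le (s := T) (p := LinearMap.ker (dotProductEquiv K n c))
    simpa [hN, SetLike.le_def, Set.subset_def] using hspan.symm
  rw [← LinearEquiv.finrank_map_eq (dotProductEquiv K n) N, hmap,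
    Subspace.finrank_add_finrank_dualAnnihilator_eq, Module.finrank_pi]

omit [Fintype n] in
theorem exists_det_ne_zero_of_linearIndependent [Finite n] {m : ℕ}
    {v : Fin m → n → K} (hv : LinearIndependent K v) :
    ∃ c : Fin m → n, (Matrix.of fun i j => v j (c i)).det ≠ 0 := by
  cases nonempty_fintype n
  have hrank : Module.finrank K (Submodule.span K (Set.range (Matrix.of v).col)) = m := by
    rw [← Matrix.rank_eq_finrank_span_cols, LinearIndependent.rank_matrix (M := Matrix.of v) hv,
      Fintype.card_fin]
  have hcols := Submodule.exists_fun_fin_finrank_span_eq K (Set.range (Matrix.of v).col)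
  rw [hrank] at hcols
  obtain ⟨f, hf, -, hli⟩ := hcols
  choose c hc using hf
  obtain rfl : (fun i j => v j (c i)) = f := funext hc
  exact ⟨c, isUnit_iff_ne_zero.mp <| (Matrix.isUnit_iff_isUnit_det _).mp <|
    Matrix.linearIndependent_rows_iff_isUnit.mp hli⟩

theorem exists_det_ne_zero_of_finrank_add_eq {T : Set (n → K)} {N : Submodule K (n → K)}
    (hN : ∀ c, c ∈ N ↔ ∀ v ∈ T, c ⬝ᵥ v = 0) {m : ℕ}
    (hm : m + Module.finrank K N = Fintype.card n) :
    ∃ v : Fin m → n → K, (∀ j, v j ∈ T) ∧ ∃ c : Fin m → n,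
      (Matrix.of fun i j => v j (c i)).det ≠ 0 := by
  obtain ⟨v, hv, -, hli⟩ := Submodule.exists_fun_fin_finrank_span_eq K T
  have hspan := finrank_span_add_finrank_eq_card hN
  obtain rfl : Module.finrank K (Submodule.span K T) = m := by omega
  exact ⟨v, hv, exists_det_ne_zero_of_linearIndependent hli⟩

theorem card_add_finrank_le_of_det_ne_zero {ι : Type*} [Fintype ι] [DecidableEq ι]
    {N : Submodule K (n → K)} {v : ι → n → K} (hN : ∀ c ∈ N, ∀ j, c ⬝ᵥ v j = 0) {c : ι → n}
    (hdet : (Matrix.of fun i j => v j (c i)).det ≠ 0) :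
    Fintype.card ι + Module.finrank K N ≤ Fintype.card n := by
  have hli : LinearIndependent K v := by
    refine LinearIndependent.of_comp (LinearMap.funLeft K K c) ?_
    exact Matrix.linearIndependent_cols_of_det_ne_zero hdet
  let P : Submodule K (n → K) :=
    ⨅ j, LinearMap.ker (dotProductBilin K K (v j))
  have hP : ∀ x, x ∈ P ↔ ∀ y ∈ Set.range v, x ⬝ᵥ y = 0 := fun x => by
    simp [P, dotProduct_comm]
  calc Fintype.card ι + Module.finrank K N
      ≤ Module.finrank K (Submodule.span K (Set.range v)) + Module.finrank K P := by
        rw [finrank_span_eq_card hli]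
        gcongr
        exact Submodule.finrank_mono fun x hx => (hP x).mpr (by simpa using hN x hx)
    _ = Fintype.card n := finrank_span_add_finrank_eq_card hP

end LinearAlgebra

section GradedMap

open HomogeneousIdeal

variable {A A' : Type*} [CommRing A] [CommRing A'] {𝒜 : ℕ → AddSubgroup A}
  {𝒜' : ℕ → AddSubgroup A'} [GradedRing 𝒜] [GradedRing 𝒜'] {φ : A →+* A'}

theorem map_decompose (hφ : ∀ n, ∀ f ∈ 𝒜 n, φ f ∈ 𝒜' n) (f : A) (n : ℕ) :
    φ (DirectSum.decompose 𝒜 f n) = DirectSum.decompose 𝒜' (φ f) n :=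
  GradedRingHom.map_directSumDecompose 𝒜 𝒜' ⟨φ, fun {n _} => hφ n _⟩

theorem map_mem_graded_iff (hφ : ∀ n, ∀ f ∈ 𝒜 n, φ f ∈ 𝒜' n) (hinj : Function.Injective φ)
    {f : A} {n : ℕ} : φ f ∈ 𝒜' n ↔ f ∈ 𝒜 n := by
  refine ⟨fun hf => ?_, hφ n f⟩
  have hfn : φ (DirectSum.decompose 𝒜 f n) = φ f := by
    rw [map_decompose hφ, DirectSum.decompose_of_mem_same 𝒜' hf]
  exact hinj hfn ▸ SetLike.coe_mem _

theorem map_mem_irrelevant_iff (hφ : ∀ n, ∀ f ∈ 𝒜 n, φ f ∈ 𝒜' n) (hinj : Function.Injective φ)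
    {f : A} : φ f ∈ (irrelevant 𝒜').toIdeal ↔ f ∈ (irrelevant 𝒜).toIdeal := by
  have hmem (x : A) : x ∈ (irrelevant 𝒜).toIdeal ↔ (DirectSum.decompose 𝒜 x 0 : A) = 0 :=
    mem_irrelevant_iff 𝒜 x
  have hmem' (x : A') : x ∈ (irrelevant 𝒜').toIdeal ↔ (DirectSum.decompose 𝒜' x 0 : A') = 0 :=
    mem_irrelevant_iff 𝒜' x
  rw [hmem, hmem', ← map_decompose hφ, map_eq_zero_iff φ hinj]

theorem GaCoaction.map_mem_centreIdeal_iff {r : ℕ} {A₀ A A₀' A' : Type u} [CommRing A₀]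
    [CommRing A] [Algebra A₀ A] [CommRing A₀'] [CommRing A'] [Algebra A₀' A']
    {a : GaCoaction r A₀ A} {a' : GaCoaction r A₀' A'} {𝒜 : ℕ → AddSubgroup A}
    {𝒜' : ℕ → AddSubgroup A'} [GradedRing 𝒜] [GradedRing 𝒜'] {φ : A →+* A'}
    (hσ : ∀ f, a'.σ (φ f) = MvPolynomial.map φ (a.σ f)) (hφ : ∀ n, ∀ f ∈ 𝒜 n, φ f ∈ 𝒜' n)
    (hinj : Function.Injective φ) {f : A} : φ f ∈ a'.centreIdeal 𝒜' ↔ f ∈ a.centreIdeal 𝒜 := by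
  simp only [centreIdeal, mem_sweepIdeal, hσ, MvPolynomial.coeff_map,
    map_mem_irrelevant_iff hφ hinj]

end GradedMap

/-! ### The geometry of cones -/

theorem exists_mem_basicOpen_of_ne_zero {Y : Scheme.{u}} [IsReduced Y] {V : Y.Opens} {f : Γ(Y, V)}
    (hf : f ≠ 0) : ∃ y, y ∈ Y.basicOpen f := by
  by_contra! h
  exact hf ((basicOpen_eq_bot_iff f).mp (le_bot_iff.mp fun y hy => h y hy))

theorem isUnit_res_of_le_basicOpen {Y : Scheme.{u}} {V W : Y.Opens} {f : Γ(Y, V)} (h : W ≤ V)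
    (hW : W ≤ Y.basicOpen f) : IsUnit ((Y.presheaf.map (homOfLE h).op).hom f) := by
  have hu := (RingedSpace.isUnit_res_basicOpen Y.toRingedSpace f).map
    (Y.presheaf.map (homOfLE hW).op).hom
  convert hu using 1
  exact congr(($(Y.presheaf.map_comp (homOfLE (Y.basicOpen_le f)).op (homOfLE hW).op)).hom f)

namespace GradedCone

open HomogeneousIdeal

variable {k : Type u} [Field k] {r w : ℕ} (X : GradedCone k r w)

instance : IsIntegral X.C := X.integral_C
instance : IsIntegral X.S := X.integral_S
instance : IsAffineHom X.π := X.affine_π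
instance : LocallyOfFiniteType (X.π ≫ X.str) := X.finiteType_C

instance (U : X.S.affineOpens) : GradedRing (X.𝒜 U) :=
  { X.graded U, (X.decomposition U).chooseDecomposition with }

instance (U : X.S.affineOpens) [Nonempty U.1] : Nonempty (X.π ⁻¹ᵁ U.1) := by
  have h1 : (1 : Γ(X.C, X.π ⁻¹ᵁ U.1)) ≠ 0 := by
    rw [← map_one (X.π.app U.1).hom]
    exact (map_ne_zero_iff _ (X.injective_app U)).mpr one_ne_zero
  obtain ⟨y, hy⟩ := exists_mem_basicOpen_of_ne_zero h1
  exact ⟨y, X.C.basicOpen_le _ hy⟩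

theorem nonempty_of_ne_zero {U : X.S.affineOpens} {f : Γ(X.C, X.π ⁻¹ᵁ U.1)} (hf : f ≠ 0) :
    Nonempty U.1 := by
  obtain ⟨y, hy⟩ := exists_mem_basicOpen_of_ne_zero hf
  exact ⟨X.π y, X.C.basicOpen_le f hy⟩

theorem isHomogeneous (U : X.S.affineOpens) : (X.coaction U).IsHomogeneous w (X.𝒜 U) :=
  X.coeff_mem U

theorem algebraMap_mem {U : X.S.affineOpens} (c : Γ(X.S, U.1)) :
    algebraMap Γ(X.S, U.1) Γ(X.C, X.π ⁻¹ᵁ U.1) c ∈ X.𝒜 U 0 :=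
  (X.mem_zero_iff U _).mpr ⟨c, rfl⟩

theorem centre_eq (U : X.S.affineOpens) : X.centre U = (X.coaction U).centreIdeal (X.𝒜 U) := by
  rw [centre, GaCoaction.centreIdeal, irrelevant_eq_span]
  rfl

theorem isAffineOpen_preimage (U : X.S.affineOpens) : IsAffineOpen (X.π ⁻¹ᵁ U.1) :=
  U.2.preimage X.π

section Restriction

variable {X} {U V W : X.S.affineOpens}

theorem preimageRes_injective (h : V.1 ≤ U.1) [Nonempty V.1] :
    Function.Injective (preimageRes X.π h) :=
  map_injective_of_isIntegral X.C (homOfLE (X.π.preimage_mono h))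

theorem preimageRes_app (h : V.1 ≤ U.1) (c : Γ(X.S, U.1)) :
    preimageRes X.π h ((X.π.app U.1).hom c) =
      (X.π.app V.1).hom ((X.S.presheaf.map (homOfLE h).op).hom c) :=
  congr($(X.π.naturality (homOfLE h).op).hom c).symm

theorem basicOpen_preimageRes (h : V.1 ≤ U.1) (f : Γ(X.C, X.π ⁻¹ᵁ U.1)) :
    X.C.basicOpen (preimageRes X.π h f) = X.π ⁻¹ᵁ V.1 ⊓ X.C.basicOpen f :=
  X.C.basicOpen_res f (homOfLE (X.π.preimage_mono h)).op

theorem preimageRes_mem_centre_iff (h : V.1 ≤ U.1) [Nonempty V.1] {f : Γ(X.C, X.π ⁻¹ᵁ U.1)} :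
    preimageRes X.π h f ∈ X.centre V ↔ f ∈ X.centre U := by
  rw [centre_eq, centre_eq]
  exact GaCoaction.map_mem_centreIdeal_iff (X.coaction_res U V h) (X.res_mem U V h)
    (preimageRes_injective h)

theorem exists_preimageRes_eq_pow_mul (h : V.1 ≤ U.1) {c : Γ(X.S, U.1)}
    (hc : X.S.basicOpen c = V.1) (f : Γ(X.C, X.π ⁻¹ᵁ V.1)) :
    ∃ (n : ℕ) (f' : Γ(X.C, X.π ⁻¹ᵁ U.1)),
      preimageRes X.π h f' = preimageRes X.π h ((X.π.app U.1).hom c) ^ n * f := by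
  let := (preimageRes X.π h).toAlgebra
  have hb : X.π ⁻¹ᵁ V.1 = X.C.basicOpen ((X.π.app U.1).hom c) := by
    rw [← hc]
    exact Scheme.preimage_basicOpen X.π c
  have : IsLocalization.Away ((X.π.app U.1).hom c) Γ(X.C, X.π ⁻¹ᵁ V.1) :=
    (X.isAffineOpen_preimage U).isLocalization_of_eq_basicOpen _
      (homOfLE (X.π.preimage_mono h)) hb
  obtain ⟨n, f', hf'⟩ := IsLocalization.Away.surj ((X.π.app U.1).hom c) f
  exact ⟨n, f', hf'.symm.trans (mul_comm _ _)⟩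

theorem exists_preimageRes_eq_app_mul (f : Γ(X.C, X.π ⁻¹ᵁ U.1)) {y : X.C}
    (hy : y ∈ X.C.basicOpen f) (hyV : y ∈ X.π ⁻¹ᵁ V.1) :
    ∃ (W : X.S.affineOpens) (hWU : W.1 ≤ U.1) (hWV : W.1 ≤ V.1), X.π y ∈ W.1 ∧
      ∃ (g : Γ(X.C, X.π ⁻¹ᵁ V.1)) (v : Γ(X.S, W.1)),
        preimageRes X.π hWV g = (X.π.app W.1).hom v * preimageRes X.π hWU f ∧
          y ∈ X.C.basicOpen g := by
  obtain ⟨c, c', hcc', hyc⟩ :=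
    exists_basicOpen_le_affine_inter V.2 U.2 (X.π y) ⟨hyV, X.C.basicOpen_le f hy⟩
  obtain ⟨W, hW⟩ : ∃ W : X.S.affineOpens, X.S.basicOpen c = W.1 := ⟨⟨_, V.2.basicOpen c⟩, rfl⟩
  have hWV : W.1 ≤ V.1 := hW ▸ X.S.basicOpen_le c
  have hWU : W.1 ≤ U.1 := hW ▸ hcc' ▸ X.S.basicOpen_le c'
  have hyW : X.π y ∈ W.1 := hW ▸ hyc
  obtain ⟨n, g, hg⟩ := exists_preimageRes_eq_pow_mul hWV hW (preimageRes X.π hWU f)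
  rw [preimageRes_app, ← map_pow] at hg
  have hv := ((isUnit_res_of_le_basicOpen hWV hW.ge).pow n).map (X.π.app W.1).hom
  have hyg : y ∈ X.C.basicOpen (preimageRes X.π hWV g) := by
    rw [hg, Scheme.basicOpen_mul, Scheme.basicOpen_of_isUnit _ hv, basicOpen_preimageRes]
    exact ⟨hyW, hyW, hy⟩
  rw [basicOpen_preimageRes] at hyg
  exact ⟨W, hWU, hWV, hyW, g, _, hg, hyg.2⟩

theorem exists_mem_centre_mem_basicOpen {f : Γ(X.C, X.π ⁻¹ᵁ U.1)} (hf : f ∈ X.centre U) {y : X.C}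
    (hy : y ∈ X.C.basicOpen f) (hyV : y ∈ X.π ⁻¹ᵁ V.1) : ∃ g ∈ X.centre V, y ∈ X.C.basicOpen g := by
  obtain ⟨W, hWU, hWV, hyW, g, v, hg, hyg⟩ := exists_preimageRes_eq_app_mul f hy hyV
  have : Nonempty W.1 := ⟨_, hyW⟩
  refine ⟨g, (preimageRes_mem_centre_iff hWV).mp ?_, hyg⟩
  rw [hg]
  exact Ideal.mul_mem_left _ _ ((preimageRes_mem_centre_iff hWU).mpr hf)

theorem pullsBackToCartier_of_forall_mem_basicOpen {f : Γ(X.C, X.π ⁻¹ᵁ U.1)}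
    (hf : f ∈ X.centre U) {T : Scheme.{u}} {F : T ⟶ X.C} (hF : ∀ t, F t ∈ X.C.basicOpen f) :
    X.PullsBackToCartier X.centre F := by
  intro V t ht
  obtain ⟨g, hg, htg⟩ := exists_mem_centre_mem_basicOpen hf (hF t) (V := V) ht
  obtain ⟨W, hW, htW, hWg⟩ := exists_isAffineOpen_mem_and_subset (U := F ⁻¹ᵁ X.C.basicOpen g) htg
  have hWV : W ≤ F ⁻¹ᵁ X.π ⁻¹ᵁ V.1 := fun x hx => X.C.basicOpen_le g (hWg hx)
  refine ⟨⟨W, hW⟩, hWV, htW, 1, one_mem _, ?_⟩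
  rw [Ideal.span_singleton_one]
  refine Ideal.eq_top_of_isUnit_mem _ (Ideal.mem_map_of_mem _ hg) ?_
  exact isUnit_res_of_le_basicOpen hWV (hWg.trans (F.preimage_basicOpen g).le)

theorem mem_zeroSection_of_forall_notMem_basicOpen {z : X.C} (hz : IsClosed {z})
    (hzV : z ∈ X.π ⁻¹ᵁ V.1) (h : ∀ n > 0, ∀ f ∈ X.𝒜 V n, z ∉ X.C.basicOpen f) :
    z ∈ X.zeroSection := by
  refine ⟨hz, fun U hzU n hn f hf => ?_⟩
  rw [Scheme.evaluation_eq_zero_iff_notMem_basicOpen]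
  intro hzf
  obtain ⟨W, hWU, hWV, hzW, g, v, hg, hzg⟩ := exists_preimageRes_eq_app_mul f hzf hzV
  have : Nonempty W.1 := ⟨_, hzW⟩
  have hgn : preimageRes X.π hWV g ∈ X.𝒜 W n := by
    rw [hg, ← zero_add n]
    exact SetLike.mul_mem_graded (X.algebraMap_mem v) (X.res_mem U W hWU n f hf)
  exact h n hn g ((map_mem_graded_iff (X.res_mem V W hWV) (preimageRes_injective hWV)).mp hgn) hzg

end Restriction
end GradedCone

theorem fromSpec_mem_basicOpen_iff {Y : Scheme.{u}} {V : Y.Opens} (hV : IsAffineOpen V)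
    (y : PrimeSpectrum Γ(Y, V)) (f : Γ(Y, V)) :
    hV.fromSpec y ∈ Y.basicOpen f ↔ f ∉ y.asIdeal := by
  rw [← PrimeSpectrum.mem_basicOpen, ← hV.fromSpec_preimage_basicOpen]
  rfl

namespace GradedCone

open HomogeneousIdeal

variable {k : Type u} [Field k] {r w : ℕ} (X : GradedCone k r w)

theorem exists_mem_zeroSection_mem_basicOpen {V : X.S.affineOpens} {f : Γ(X.C, X.π ⁻¹ᵁ V.1)}
    (hf : f ∈ X.𝒜 V 0) (hf0 : f ≠ 0) : ∃ z ∈ X.zeroSection, z ∈ X.C.basicOpen f := by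
  have := X.nonempty_of_ne_zero hf0
  have : JacobsonSpace X.C := LocallyOfFiniteType.jacobsonSpace (X.π ≫ X.str)
  let y : PrimeSpectrum Γ(X.C, X.π ⁻¹ᵁ V.1) := ⟨_, isPrime_irrelevant (X.𝒜 V)⟩
  let Z : Set X.C := X.C.zeroLocus (⋃ n > 0, (X.𝒜 V n : Set Γ(X.C, X.π ⁻¹ᵁ V.1)))
  have hZ (x : X.C) : x ∈ Z ↔ ∀ n > 0, ∀ g ∈ X.𝒜 V n, x ∉ X.C.basicOpen g := by
    simp only [Z, Scheme.mem_zeroLocus_iff, Set.mem_iUnion₂, SetLike.mem_coe]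
    exact ⟨fun h n hn g hg => h g ⟨n, hn, hg⟩, fun h g ⟨n, hn, hg⟩ => h n hn g hg⟩
  have hy : (X.isAffineOpen_preimage V).fromSpec y ∈ (X.C.basicOpen f : Set X.C) ∩ Z := by
    refine ⟨(fromSpec_mem_basicOpen_iff _ y f).mpr fun h =>
      hf0 (GaCoaction.eq_zero_of_mem_irrelevant hf h), (hZ _).mpr fun n hn g hg h => ?_⟩
    exact (fromSpec_mem_basicOpen_iff _ y g).mp h (mem_irrelevant_of_mem _ hn hg)
  obtain ⟨z, ⟨hzf, hzZ⟩, hz⟩ := nonempty_inter_closedPoints ⟨_, hy⟩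
    ((X.C.basicOpen f).isOpen.isLocallyClosed.inter (Scheme.zeroLocus_isClosed _ _).isLocallyClosed)
  exact ⟨z, mem_zeroSection_of_forall_notMem_basicOpen hz (X.C.basicOpen_le f hzf)
    ((hZ z).mp hzZ), hzf⟩

theorem zeroSection_nonempty : X.zeroSection.Nonempty := by
  obtain ⟨y⟩ : Nonempty X.S := inferInstance
  obtain ⟨U, hU, hyU, -⟩ := exists_isAffineOpen_mem_and_subset (TopologicalSpace.Opens.mem_top y)
  obtain ⟨V, rfl⟩ : ∃ V : X.S.affineOpens, V.1 = U := ⟨⟨U, hU⟩, rfl⟩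
  have : Nonempty V.1 := ⟨y, hyU⟩
  obtain ⟨z, hz, -⟩ := X.exists_mem_zeroSection_mem_basicOpen (V := V)
    (SetLike.one_mem_graded (X.𝒜 V)) one_ne_zero
  exact ⟨z, hz⟩

theorem exists_finrank_stab_eq_d : ∃ z ∈ X.zeroSection, Module.finrank k (X.stab z) = X.d :=
  Nat.sInf_mem (X.zeroSection_nonempty.image _)

variable {X} in
theorem d_le_finrank_stab {z : X.C} (hz : z ∈ X.zeroSection) :
    X.d ≤ Module.finrank k (X.stab z) :=
  Nat.sInf_le ⟨z, hz, rfl⟩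

theorem d_le : X.d ≤ r := by
  obtain ⟨z, -, hz⟩ := X.exists_finrank_stab_eq_d
  simpa [hz] using Submodule.finrank_le (X.stab z)

theorem exists_mem_fit_of_e_lt_top (he : X.e < ⊤) : ∃ n : ℕ, X.e = n ∧
    ∃ U : X.S.affineOpens, ∃ f ∈ X.fit (X.d - 1) U, f ∈ X.𝒜 U n ∧ f ≠ 0 := by
  have hne : ((fun n : ℕ => (n : ℕ∞)) '' {n | ∃ U : X.S.affineOpens,
      ∃ f ∈ X.fit ((X.d : ℤ) - 1) U, f ∈ X.𝒜 U n ∧ f ≠ 0}).Nonempty := by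
    by_contra! h
    rw [e, h, sInf_empty] at he
    exact he.false
  obtain ⟨n, hn, hne⟩ := csInf_mem hne
  exact ⟨n, hne.symm, hn⟩

end GradedCone

/-! ### Values at closed points -/

section Scalars

variable {k : Type u} [Field k] {Y : Scheme.{u}} (s : Y ⟶ Spec (.of k))

theorem res_scalar {V W : Y.Opens} (h : W ≤ V) (c : k) :
    (Y.presheaf.map (homOfLE h).op).hom (scalar s V c) = scalar s W c :=
  congr(($(Scheme.Hom.appLE_map s le_top (homOfLE h).op)).hom
    ((Scheme.ΓSpecIso (.of k)).inv.hom c))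

theorem evaluation_res {V W : Y.Opens} (h : W ≤ V) (x : Y) (hx : x ∈ W) (f : Γ(Y, V)) :
    Y.evaluation W x hx ((Y.presheaf.map (homOfLE h).op).hom f) = Y.evaluation V x (h hx) f :=
  congrArg (Y.residue x).hom (TopCat.Presheaf.germ_res_apply _ (homOfLE h) x hx f)

theorem fromSpecResidueField_appTop (x : Y) :
    (Y.fromSpecResidueField x).appTop =
      Y.evaluation ⊤ x (TopologicalSpace.Opens.mem_top x) ≫
        (Scheme.ΓSpecIso (Y.residueField x)).inv := by
  have h : (Y.fromSpecStalk x).appTop = Y.presheaf.germ ⊤ x (TopologicalSpace.Opens.mem_top x) ≫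
      (Scheme.ΓSpecIso (Y.presheaf.stalk x)).inv := by
    rw [Scheme.fromSpecStalk_appTop]
    simp
  rw [Scheme.fromSpecResidueField, Scheme.Hom.comp_appTop, h, Category.assoc,
    ← Scheme.ΓSpecIso_inv_naturality]
  rfl

theorem evaluation_comp_scalar [IsAlgClosed k] [LocallyOfFiniteType s] {x : Y} (hx : IsClosed {x})
    {V : Y.Opens} (hxV : x ∈ V) :
    (Y.evaluation V x hxV).hom.comp (scalar s V) = (residueFieldIsoBase s x hx).inv.hom := by
  have htop : (Scheme.ΓSpecIso (.of k)).inv ≫ s.appTop ≫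
      Y.evaluation ⊤ x (TopologicalSpace.Opens.mem_top x) = (residueFieldIsoBase s x hx).inv := by
    rw [← cancel_mono (Scheme.ΓSpecIso (Y.residueField x)).inv,
      Scheme.ΓSpecIso_inv_naturality (residueFieldIsoBase s x hx).inv,
      SpecMap_residueFieldIsoBase_inv, Scheme.Hom.comp_appTop, fromSpecResidueField_appTop,
      Category.assoc, Category.assoc]
  have happ : s.appLE ⊤ ⊤ le_top = s.appTop := s.appLE_eq_app
  rw [← htop, ← happ]
  ext c
  rw [RingHom.comp_apply, ← res_scalar s (le_top : V ≤ ⊤) c]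
  exact evaluation_res le_top x hxV _

theorem bijective_evaluation_comp_scalar [IsAlgClosed k] [LocallyOfFiniteType s] {x : Y}
    (hx : IsClosed {x}) {V : Y.Opens} (hxV : x ∈ V) :
    Function.Bijective ((Y.evaluation V x hxV).hom.comp (scalar s V)) := by
  rw [evaluation_comp_scalar s hx hxV]
  exact ConcreteCategory.bijective_of_isIso (residueFieldIsoBase s x hx).inv

end Scalars

namespace GradedCone

variable {k : Type u} [Field k] {r w : ℕ} {X : GradedCone k r w}

theorem vectorField_preimageRes {U V : X.S.affineOpens} (h : V.1 ≤ U.1) (i : Fin r)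
    (f : Γ(X.C, X.π ⁻¹ᵁ U.1)) :
    (X.coaction V).vectorField i (preimageRes X.π h f) =
      preimageRes X.π h ((X.coaction U).vectorField i f) :=
  GaCoaction.vectorField_map (X.coaction_res U V h) i f

theorem exists_affineOpens_mem_forall_le {z : X.C} {ι : Type*} [Finite ι]
    {U : ι → X.S.affineOpens} (hzU : ∀ j, z ∈ X.π ⁻¹ᵁ (U j).1) :
    ∃ V : X.S.affineOpens, z ∈ X.π ⁻¹ᵁ V.1 ∧ ∀ j, V.1 ≤ (U j).1 := by
  obtain ⟨V, hV, hzV, hle⟩ := exists_isAffineOpen_mem_and_subset (x := X.π z)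
    (U := ⨅ j, (U j).1) (by
      rw [← SetLike.mem_coe, TopologicalSpace.Opens.coe_iInf]
      exact Set.mem_iInter.mpr hzU)
  exact ⟨⟨V, hV⟩, hzV, fun j => (show V ≤ ⨅ j, (U j).1 from hle).trans (iInf_le _ j)⟩

section Values

variable (X) [IsAlgClosed k] {z : X.C} (hz : IsClosed {z})

/-- The residue field at a closed point, identified with `k` through the constant functions. -/
def residueEquiv : k ≃+* X.C.residueField z :=
  RingEquiv.ofBijective _ (bijective_evaluation_comp_scalar (X.π ≫ X.str) hz
    (TopologicalSpace.Opens.mem_top z))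

/-- The value `f z ∈ k` of a function `f` at a closed point `z`; in contrast to
`Scheme.evaluation` it does not take values in the residue field at `z`, so that values at `z`
can be compared with vectors in `𝔲 = kʳ`. -/
def value (V : X.C.Opens) (hzV : z ∈ V) : Γ(X.C, V) →+* k :=
  (X.residueEquiv hz).symm.toRingHom.comp (X.C.evaluation V z hzV).hom

variable {X}

theorem value_eq_zero_iff {V : X.C.Opens} {hzV : z ∈ V} {f : Γ(X.C, V)} :
    X.value hz V hzV f = 0 ↔ X.C.evaluation V z hzV f = 0 :=
  map_eq_zero_iff (X.residueEquiv hz).symm (X.residueEquiv hz).symm.injective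

theorem value_scalar (V : X.C.Opens) (hzV : z ∈ V) (c : k) :
    X.value hz V hzV (scalar (X.π ≫ X.str) V c) = c := by
  refine (RingEquiv.symm_apply_eq (X.residueEquiv hz)).mpr ?_
  rw [← res_scalar (X.π ≫ X.str) (le_top : V ≤ ⊤) c]
  exact evaluation_res le_top z hzV _

theorem value_res {V W : X.C.Opens} (h : W ≤ V) (hzW : z ∈ W) (f : Γ(X.C, V)) :
    X.value hz W hzW ((X.C.presheaf.map (homOfLE h).op).hom f) = X.value hz V (h hzW) f :=
  congrArg (X.residueEquiv hz).symm (evaluation_res h z hzW f)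

theorem mem_stab_iff {c : Fin r → k} :
    c ∈ X.stab z ↔ ∀ (U : X.S.affineOpens) (hzU : z ∈ X.π ⁻¹ᵁ U.1) (f : Γ(X.C, X.π ⁻¹ᵁ U.1)),
      c ⬝ᵥ (fun i => X.value hz _ hzU ((X.coaction U).vectorField i f)) = 0 := by
  refine forall_congr' fun U => forall_congr' fun hzU => forall_congr' fun f => ?_
  rw [← value_eq_zero_iff hz, map_sum]
  simp only [map_mul, value_scalar]
  rfl

/- A vector field lowers the degree by `w`, so for `f` homogeneous of degree `≠ w` all `ξᵢ f`
vanish on the zero section. -/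
theorem mem_stab_iff_of_mem_zeroSection (hzZ : z ∈ X.zeroSection) {c : Fin r → k} :
    c ∈ X.stab z ↔ ∀ (U : X.S.affineOpens) (hzU : z ∈ X.π ⁻¹ᵁ U.1), ∀ f ∈ X.𝒜 U w,
      c ⬝ᵥ (fun i => X.value hz _ hzU ((X.coaction U).vectorField i f)) = 0 := by
  classical
  rw [mem_stab_iff hz]
  refine ⟨fun h U hzU f _ => h U hzU f, fun h U hzU f => ?_⟩
  rw [← DirectSum.sum_support_decompose (X.𝒜 U) f]
  simp only [dotProduct, map_sum, Finset.mul_sum]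
  rw [Finset.sum_comm]
  refine Finset.sum_eq_zero fun n _ => ?_
  have hn := (DirectSum.decompose (X.𝒜 U) f n).2
  rcases lt_trichotomy n w with hlt | rfl | hlt
  · refine Finset.sum_eq_zero fun i _ => ?_
    rw [(X.isHomogeneous U).vectorField_eq_zero hn hlt, map_zero, mul_zero]
  · exact h U hzU _ hn
  · refine Finset.sum_eq_zero fun i _ => ?_
    rw [(value_eq_zero_iff hz).mpr (hzZ.2 U hzU (n - w) (by omega) _
      ((X.isHomogeneous U).vectorField_mem hn (by omega) i)), mul_zero]

theorem exists_value_det_ne_zero (hzZ : z ∈ X.zeroSection) {m : ℕ}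
    (hm : m + Module.finrank k (X.stab z) = r) :
    ∃ (U : X.S.affineOpens) (hzU : z ∈ X.π ⁻¹ᵁ U.1) (s : Fin m → Γ(X.C, X.π ⁻¹ᵁ U.1))
      (c : Fin m → Fin r), (∀ j, s j ∈ X.𝒜 U w) ∧ X.value hz _ hzU
        (Matrix.of fun i j => (X.coaction U).vectorField (c i) (s j)).det ≠ 0 := by
  let T : Set (Fin r → k) := {v | ∃ (U : X.S.affineOpens) (hzU : z ∈ X.π ⁻¹ᵁ U.1), ∃ f ∈ X.𝒜 U w,
    v = fun i => X.value hz _ hzU ((X.coaction U).vectorField i f)}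
  have hT : ∀ c, c ∈ X.stab z ↔ ∀ v ∈ T, c ⬝ᵥ v = 0 := by
    intro c
    rw [mem_stab_iff_of_mem_zeroSection hz hzZ]
    refine ⟨?_, fun h U hzU f hf => h _ ⟨U, hzU, f, hf, rfl⟩⟩
    rintro h _ ⟨U, hzU, f, hf, rfl⟩
    exact h U hzU f hf
  obtain ⟨v, hvT, c, hdet⟩ := exists_det_ne_zero_of_finrank_add_eq hT (hm.trans (by simp))
  choose U hzU f hf hv using hvT
  obtain ⟨V, hzV, hVU⟩ := exists_affineOpens_mem_forall_le hzU
  refine ⟨V, hzV, fun j => preimageRes X.π (hVU j) (f j), c,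
    fun j => X.res_mem (U j) V (hVU j) w _ (hf j), ?_⟩
  have hres : ∀ i j, X.value hz _ hzV
      ((X.coaction V).vectorField (c i) (preimageRes X.π (hVU j) (f j))) = v j (c i) := by
    intro i j
    rw [vectorField_preimageRes, hv j]
    exact value_res hz (X.π.preimage_mono (hVU j)) hzV _
  rw [RingHom.map_det]
  convert hdet using 2
  ext i j
  exact hres i j

theorem card_add_finrank_stab_le {U : X.S.affineOpens} (hzU : z ∈ X.π ⁻¹ᵁ U.1)
    {ι : Type*} [Fintype ι] [DecidableEq ι] (s : ι → Γ(X.C, X.π ⁻¹ᵁ U.1)) (c : ι → Fin r)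
    (hdet : X.value hz _ hzU
      (Matrix.of fun i j => (X.coaction U).vectorField (c i) (s j)).det ≠ 0) :
    Fintype.card ι + Module.finrank k (X.stab z) ≤ r := by
  rw [RingHom.map_det] at hdet
  have := card_add_finrank_le_of_det_ne_zero (N := X.stab z) (c := c)
    (v := fun j i => X.value hz _ hzU ((X.coaction U).vectorField i (s j)))
    (fun x hx j => (mem_stab_iff hz).mp hx U hzU (s j)) hdet
  simpa using this

end Values

end GradedCone

/-! ### Slices on open subsets of a cone -/

theorem GaCoaction.exists_isSlice_of_isUnit_det {r w : ℕ} {A₀ A : Type u} {ι : Type*}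
    [CommRing A₀] [CommRing A] [Algebra A₀ A] [Fintype ι] [DecidableEq ι] {a : GaCoaction r A₀ A}
    {𝒜 : ℕ → AddSubgroup A} [SetLike.GradedMonoid 𝒜] (h0 : ∀ x, algebraMap A₀ A x ∈ 𝒜 0)
    {c : ι → Fin r} {s : ι → A} (hs : ∀ j, s j ∈ 𝒜 w) {m : Matrix ι ι A₀}
    (hm : ∀ i j, algebraMap A₀ A (m i j) = a.vectorField (c i) (s j)) (hdet : IsUnit m.det) :
    ∃ s' : ι → A, a.IsSlice w 𝒜 c s' := by
  refine ⟨fun j => ∑ l, m⁻¹ l j • s l, fun j => sum_mem fun l _ => ?_, fun i j => ?_⟩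
  · simpa [Algebra.smul_def] using SetLike.mul_mem_graded (h0 (m⁻¹ l j)) (hs l)
  · calc a.vectorField (c i) (∑ l, m⁻¹ l j • s l) = algebraMap A₀ A ((m * m⁻¹) i j) := by
          simp only [map_sum, Derivation.map_smul, Matrix.mul_apply, map_mul, hm]
          exact Finset.sum_congr rfl fun l _ => by rw [Algebra.smul_def, mul_comm]
      _ = if i = j then 1 else 0 := by
          rw [Matrix.mul_nonsing_inv m hdet, Matrix.one_apply]
          split_ifs <;> simp

namespace GradedCone

variable {k : Type u} [Field k] {r w : ℕ} {X : GradedCone k r w} {U : X.S.affineOpens}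
  {ι : Type*} {c : ι → Fin r} {s : ι → Γ(X.C, X.π ⁻¹ᵁ U.1)}

theorem exists_app_eq_vectorField (hs : ∀ j, s j ∈ X.𝒜 U w) :
    ∃ m : Matrix ι ι Γ(X.S, U.1),
      ∀ i j, (X.π.app U.1).hom (m i j) = (X.coaction U).vectorField (c i) (s j) := by
  have h : ∀ i j, ∃ y, (X.π.app U.1).hom y = (X.coaction U).vectorField (c i) (s j) := fun i j =>
    (X.mem_zero_iff U _).mp ((X.isHomogeneous U).vectorField_mem (hs j) (zero_add w) (c i))
  choose m hm using h
  exact ⟨m, hm⟩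

variable [Fintype ι] [DecidableEq ι]

theorem det_vectorField_mem (hs : ∀ j, s j ∈ X.𝒜 U w) :
    (Matrix.of fun i j => (X.coaction U).vectorField (c i) (s j)).det ∈ X.𝒜 U 0 := by
  obtain ⟨m, hm⟩ := exists_app_eq_vectorField (c := c) hs
  refine (X.mem_zero_iff U _).mpr ⟨m.det, ?_⟩
  rw [RingHom.map_det]
  exact congrArg Matrix.det (Matrix.ext hm)

theorem d_add_card_le_of_det_ne_zero [IsAlgClosed k] (hs : ∀ j, s j ∈ X.𝒜 U w)
    (hdet : (Matrix.of fun i j => (X.coaction U).vectorField (c i) (s j)).det ≠ 0) :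
    X.d + Fintype.card ι ≤ r := by
  obtain ⟨z, hz, hzb⟩ := X.exists_mem_zeroSection_mem_basicOpen (det_vectorField_mem hs) hdet
  have hrank := card_add_finrank_stab_le hz.1 (X.C.basicOpen_le _ hzb) s c <| by
    rwa [Ne, value_eq_zero_iff, Scheme.evaluation_eq_zero_iff_notMem_basicOpen, not_not]
  have := d_le_finrank_stab hz
  omega

theorem d_add_card_le_of_isSlice [IsAlgClosed k] [Nonempty U.1]
    (hs : (X.coaction U).IsSlice w (X.𝒜 U) c s) : X.d + Fintype.card ι ≤ r := by
  refine d_add_card_le_of_det_ne_zero (c := c) hs.mem ?_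
  have hone : (Matrix.of fun i j => (X.coaction U).vectorField (c i) (s j)) = 1 := by
    ext i j
    rw [Matrix.of_apply, hs.vectorField_apply, Matrix.one_apply]
  rw [hone, Matrix.det_one]
  exact one_ne_zero

theorem transverse_eq_zero_of_isSlice [IsAlgClosed k]
    (hs : (X.coaction U).IsSlice w (X.𝒜 U) c s) (hc : r ≤ X.d + Fintype.card ι)
    {f : Γ(X.C, X.π ⁻¹ᵁ U.1)} (hf : f ∈ X.𝒜 U w) (i : Fin r) :
    (X.coaction U).transverse c s i f = 0 := by
  by_contra hne
  rw [← hs.det_eq_transverse, ← Matrix.det_transpose] at hne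
  have hcard := d_add_card_le_of_det_ne_zero (s := Sum.elim s fun _ : Unit => f)
    (Sum.rec hs.mem fun _ => hf) hne
  rw [Fintype.card_sum, Fintype.card_unit] at hcard
  omega

theorem exists_isSlice_of_det_ne_zero (hs : ∀ j, s j ∈ X.𝒜 U w)
    (hdet : (Matrix.of fun i j => (X.coaction U).vectorField (c i) (s j)).det ≠ 0)
    (U₀ : X.S.affineOpens) [Nonempty U₀.1] :
    ∃ V : X.S.affineOpens, Nonempty V.1 ∧ V.1 ≤ U₀.1 ∧
      ∃ s' : ι → Γ(X.C, X.π ⁻¹ᵁ V.1), (X.coaction V).IsSlice w (X.𝒜 V) c s' := by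
  obtain ⟨m, hm⟩ := exists_app_eq_vectorField (c := c) hs
  have hm0 : m.det ≠ 0 := by
    intro h0
    refine hdet ?_
    rw [← map_zero (X.π.app U.1).hom, ← h0, RingHom.map_det]
    exact congrArg Matrix.det (Matrix.ext fun i j => (hm i j).symm)
  obtain ⟨y, hyU, hym⟩ := nonempty_preirreducible_inter U₀.1.isOpen
    (X.S.basicOpen m.det).isOpen (Set.nonempty_coe_sort.mp ‹_›)
    (exists_mem_basicOpen_of_ne_zero hm0)
  obtain ⟨V, hV, hyV, hVle⟩ := exists_isAffineOpen_mem_and_subset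
    (U := U₀.1 ⊓ X.S.basicOpen m.det) ⟨hyU, hym⟩
  obtain ⟨V, rfl⟩ : ∃ W : X.S.affineOpens, W.1 = V := ⟨⟨V, hV⟩, rfl⟩
  have hVm : V.1 ≤ X.S.basicOpen m.det := fun x hx => (hVle hx).2
  have hVU : V.1 ≤ U.1 := hVm.trans (X.S.basicOpen_le _)
  refine ⟨V, ⟨y, hyV⟩, fun x hx => (hVle hx).1, ?_⟩
  let ρ := (X.S.presheaf.map (homOfLE hVU).op).hom
  refine GaCoaction.exists_isSlice_of_isUnit_det (s := fun j => preimageRes X.π hVU (s j))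
    (m := ρ.mapMatrix m) X.algebraMap_mem (fun j => X.res_mem U V hVU w _ (hs j)) (fun i j => ?_) ?_
  · rw [vectorField_preimageRes, ← hm, preimageRes_app]
    rfl
  · rw [← RingHom.map_det]
    exact isUnit_res_of_le_basicOpen hVU hVm

variable (X) in
theorem exists_isSlice [IsAlgClosed k] (U₀ : X.S.affineOpens) [Nonempty U₀.1] :
    ∃ V : X.S.affineOpens, Nonempty V.1 ∧ V.1 ≤ U₀.1 ∧
      ∃ (c : Fin (r - X.d) → Fin r) (s : Fin (r - X.d) → Γ(X.C, X.π ⁻¹ᵁ V.1)),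
        (X.coaction V).IsSlice w (X.𝒜 V) c s := by
  obtain ⟨z, hz, hzd⟩ := X.exists_finrank_stab_eq_d
  obtain ⟨U, hzU, s, c, hs, hdet⟩ := exists_value_det_ne_zero hz.1 hz (m := r - X.d) <| by
    rw [hzd, Nat.sub_add_cancel X.d_le]
  obtain ⟨V, hV, hVU₀, s', hs'⟩ := exists_isSlice_of_det_ne_zero hs
    (fun h0 => hdet (by rw [h0, map_zero])) U₀
  exact ⟨V, hV, hVU₀, c, s', hs'⟩

end GradedCone

/-! ### Pulling back the centre -/

theorem appLE_comp_germ {Y T : Scheme.{u}} (F : T ⟶ Y) {U : Y.Opens} {V : T.Opens}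
    (h : V ≤ F ⁻¹ᵁ U) {t : T} (ht : t ∈ V) :
    F.appLE U V h ≫ T.presheaf.germ V t ht = F.app U ≫ T.presheaf.germ (F ⁻¹ᵁ U) t (h ht) := by
  rw [Scheme.Hom.appLE, Category.assoc, TopCat.Presheaf.germ_res]

theorem map_mem_nonZeroDivisors_of_flat {R R' : Type*} [CommRing R] [CommRing R'] {φ : R →+* R'}
    (hφ : φ.Flat) {x : R} (hx : x ∈ nonZeroDivisors R) : φ x ∈ nonZeroDivisors R' := by
  let := φ.toAlgebra
  have : Module.Flat R R' := hφ
  refine mem_nonZeroDivisors_iff_right.mpr fun y hy => ?_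
  refine Module.Flat.isSMulRegular_of_nonZeroDivisors (M := R') hx ?_
  simpa [Algebra.smul_def, RingHom.algebraMap_toAlgebra, mul_comm] using hy

namespace GradedCone

variable {k : Type u} [Field k] {r w : ℕ} {X : GradedCone k r w}
  {J : (U : X.S.affineOpens) → Ideal Γ(X.C, X.π ⁻¹ᵁ U.1)} {T : Scheme.{u}} {F : T ⟶ X.C}

theorem PullsBackToCartier.comp_flat (hF : X.PullsBackToCartier J F) {T' : Scheme.{u}}
    (G : T' ⟶ T) [Flat G] : X.PullsBackToCartier J (G ≫ F) := by
  intro U t ht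
  obtain ⟨W, hWU, htW, g, hg, hJ⟩ := hF U (G t) ht
  obtain ⟨W', hW', htW', hle⟩ := exists_isAffineOpen_mem_and_subset (U := G ⁻¹ᵁ W.1) htW
  refine ⟨⟨W', hW'⟩, hle.trans (G.preimage_mono hWU), htW', (G.appLE W.1 W' hle).hom g,
    map_mem_nonZeroDivisors_of_flat (G.flat_appLE W.2 hW' hle) hg, ?_⟩
  rw [← Scheme.Hom.appLE_comp_appLE G F (X.π ⁻¹ᵁ U.1) W.1 W' hWU hle, CommRingCat.hom_comp,
    ← Ideal.map_map, hJ, Ideal.map_span, Set.image_singleton]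

theorem PullsBackToCartier.exists_map_germ_eq_span [IsIntegral T]
    (hF : X.PullsBackToCartier J F) (U : X.S.affineOpens) {V : T.Opens}
    (h : V ≤ F ⁻¹ᵁ X.π ⁻¹ᵁ U.1) {t : T} (ht : t ∈ V) :
    ∃ γ : T.presheaf.stalk t, γ ≠ 0 ∧
      (J U).map ((T.presheaf.germ V t ht).hom.comp (F.appLE (X.π ⁻¹ᵁ U.1) V h).hom) =
        Ideal.span {γ} := by
  obtain ⟨W, hW, htW, g, hg, hJ⟩ := hF U t (h ht)
  have : Nonempty W.1 := ⟨t, htW⟩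
  refine ⟨(T.presheaf.germ W.1 t htW).hom g, (map_ne_zero_iff _
    (germ_injective_of_isIntegral T t htW)).mpr (nonZeroDivisors.ne_zero hg), ?_⟩
  rw [← CommRingCat.hom_comp, appLE_comp_germ, ← appLE_comp_germ F hW htW, CommRingCat.hom_comp,
    ← Ideal.map_map, hJ, Ideal.map_span, Set.image_singleton]

theorem PullsBackToCartier.exists_mem_basicOpen [IsIntegral T] (hF : X.PullsBackToCartier J F) :
    ∃ U, ∃ f ∈ J U, ∃ t, F t ∈ X.C.basicOpen f := by
  obtain ⟨t⟩ : Nonempty T := inferInstance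
  obtain ⟨U, hU, htU, -⟩ := exists_isAffineOpen_mem_and_subset
    (TopologicalSpace.Opens.mem_top (X.π (F t)))
  obtain ⟨γ, hγ, hJ⟩ := hF.exists_map_germ_eq_span ⟨U, hU⟩ le_rfl htU
  by_contra! hempty
  refine hγ ?_
  rw [← Ideal.span_singleton_eq_bot, ← hJ, Ideal.map_eq_bot_iff_le_ker]
  intro f hf
  have hf0 : (F.appLE (X.π ⁻¹ᵁ U) _ le_rfl).hom f = 0 := by
    by_contra hne
    obtain ⟨y, hy⟩ := exists_mem_basicOpen_of_ne_zero hne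
    exact hempty ⟨U, hU⟩ f hf y ((Scheme.basicOpen_appLE F _ _ le_rfl f).le hy).2
  rw [RingHom.mem_ker, RingHom.comp_apply, hf0, map_zero]

/- By the universal property, `b` is an isomorphism over the basic open subsets defined by
functions in the ideal of the centre. -/
theorem IsBlowup.isOpen_image {B : Scheme.{u}} {b : B ⟶ X.C} (hb : X.IsBlowup X.centre b)
    {U : X.S.affineOpens} {f : Γ(X.C, X.π ⁻¹ᵁ U.1)} (hf : f ∈ X.centre U) {V : B.Opens}
    (hV : V ≤ b ⁻¹ᵁ X.C.basicOpen f) : IsOpen (b '' (V : Set B)) := by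
  set D := X.C.basicOpen f
  obtain ⟨g, hg, -⟩ := hb.lift D.ι (pullsBackToCartier_of_forall_mem_basicOpen hf fun t => t.2)
  have hlift : (b ∣_ D) ≫ g = (b ⁻¹ᵁ D).ι :=
    (hb.lift ((b ⁻¹ᵁ D).ι ≫ b)
      (pullsBackToCartier_of_forall_mem_basicOpen hf fun t => t.2)).unique
      (by rw [Category.assoc, hg, morphismRestrict_ι]) rfl
  have himage : b '' (V : Set B) = (D.ι ''ᵁ (g ⁻¹ᵁ V) : X.C.Opens) := by
    refine Set.Subset.antisymm ?_ ?_
    · rintro _ ⟨x, hx, rfl⟩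
      refine ⟨(b ∣_ D) ⟨x, hV hx⟩, ?_, ?_⟩
      · change ((b ∣_ D) ≫ g) ⟨x, hV hx⟩ ∈ V
        rwa [hlift]
      · exact congr($(morphismRestrict_ι b D) ⟨x, hV hx⟩)
    · rintro _ ⟨t, ht, rfl⟩
      exact ⟨g t, ht, congr($hg t)⟩
  rw [himage]
  exact TopologicalSpace.Opens.isOpen _

namespace Modification

variable {X' : GradedCone k r w}

theorem pullsBackToCartier (M : X.Modification J X') : X.PullsBackToCartier J (M.ι ≫ M.b) :=
  have := M.isOpenImmersion
  M.isBlowup.cartier.comp_flat M.ι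

theorem isDominant (M : X.Modification X.centre X') : IsDominant (M.ι ≫ M.b) := by
  have := M.isOpenImmersion
  obtain ⟨U, f, hf, y, hy⟩ := M.pullsBackToCartier.exists_mem_basicOpen
  have hopen := M.isBlowup.isOpen_image hf
    (inf_le_right : M.ι.opensRange ⊓ M.b ⁻¹ᵁ X.C.basicOpen f ≤ _)
  refine ⟨(hopen.dense ⟨_, M.ι y, ⟨⟨y, rfl⟩, hy⟩, rfl⟩).mono ?_⟩
  rintro _ ⟨_, ⟨⟨x, rfl⟩, -⟩, rfl⟩
  exact ⟨x, rfl⟩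

end Modification

/-! ### Equivariant morphisms of cones -/

/-- A morphism from the cone `X'` to the cone `X`, lying over a morphism of the bases, that is
equivariant for `𝔾ₘ` (it preserves degrees) and for `𝔾ₐʳ`. Both conditions are imposed over
affine open subsets of the bases, where `𝒜` and the co-actions are given; no compatibility with
the structure morphisms to `Spec k` is included. -/
structure EquivariantHom (X' X : GradedCone k r w) where
  total : X'.C ⟶ X.C
  base : X'.S ⟶ X.S
  comm : X'.π ≫ base = total ≫ X.π
  map_mem : ∀ (U : X.S.affineOpens) (U' : X'.S.affineOpens)
    (h : X'.π ⁻¹ᵁ U'.1 ≤ total ⁻¹ᵁ X.π ⁻¹ᵁ U.1), U'.1 ≤ base ⁻¹ᵁ U.1 → ∀ n, ∀ f ∈ X.𝒜 U n,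
      (total.appLE (X.π ⁻¹ᵁ U.1) (X'.π ⁻¹ᵁ U'.1) h).hom f ∈ X'.𝒜 U' n
  map_coaction : ∀ (U : X.S.affineOpens) (U' : X'.S.affineOpens)
    (h : X'.π ⁻¹ᵁ U'.1 ≤ total ⁻¹ᵁ X.π ⁻¹ᵁ U.1), U'.1 ≤ base ⁻¹ᵁ U.1 →
    ∀ f : Γ(X.C, X.π ⁻¹ᵁ U.1),
      (X'.coaction U').σ ((total.appLE (X.π ⁻¹ᵁ U.1) (X'.π ⁻¹ᵁ U'.1) h).hom f) =
        MvPolynomial.map (total.appLE (X.π ⁻¹ᵁ U.1) (X'.π ⁻¹ᵁ U'.1) h).hom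
          ((X.coaction U).σ f)

/-- The equivariant morphism `C' → C` of a modification. -/
def Modification.equivariantHom {X' : GradedCone k r w} (M : X.Modification J X') :
    X'.EquivariantHom X where
  total := M.ι ≫ M.b
  base := M.q
  comm := by rw [M.comm, Category.assoc]
  map_mem := M.map_mem
  map_coaction := M.map_coaction

theorem EquivariantHom.exists_affineOpens_le_preimage {X' : GradedCone k r w}
    (p : X'.EquivariantHom X) [IsDominant p.total] (U : X.S.affineOpens) [Nonempty U.1] :
    ∃ U' : X'.S.affineOpens, Nonempty U'.1 ∧ U'.1 ≤ p.base ⁻¹ᵁ U.1 := by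
  obtain ⟨y⟩ : Nonempty (X.π ⁻¹ᵁ U.1) := inferInstance
  obtain ⟨x, hx⟩ := p.total.denseRange.exists_mem_open (X.π ⁻¹ᵁ U.1).isOpen ⟨y.1, y.2⟩
  have hxU : X'.π x ∈ p.base ⁻¹ᵁ U.1 := by
    change (X'.π ≫ p.base) x ∈ U.1
    rw [p.comm]
    exact hx
  obtain ⟨U', hU', hxU', hle⟩ := exists_isAffineOpen_mem_and_subset hxU
  exact ⟨⟨U', hU'⟩, ⟨_, hxU'⟩, hle⟩

theorem EquivariantHom.preimage_le {X' : GradedCone k r w} (p : X'.EquivariantHom X)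
    {U : X.S.affineOpens} {U' : X'.S.affineOpens} (h : U'.1 ≤ p.base ⁻¹ᵁ U.1) :
    X'.π ⁻¹ᵁ U'.1 ≤ p.total ⁻¹ᵁ X.π ⁻¹ᵁ U.1 := by
  rw [← Scheme.Hom.comp_preimage, ← p.comm, Scheme.Hom.comp_preimage]
  exact X'.π.preimage_mono h

end GradedCone

theorem appLE_injective_of_isDominant {T Y : Scheme.{u}} [IsIntegral T] [IsReduced Y] (F : T ⟶ Y)
    [IsDominant F] {U : Y.Opens} {V : T.Opens} [Nonempty V] (h : V ≤ F ⁻¹ᵁ U) :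
    Function.Injective (F.appLE U V h).hom := by
  rw [injective_iff_map_eq_zero]
  intro f hf
  by_contra hf0
  obtain ⟨y, hy⟩ := exists_mem_basicOpen_of_ne_zero hf0
  obtain ⟨x, hx⟩ := F.denseRange.exists_mem_open (Y.basicOpen f).isOpen ⟨y, hy⟩
  obtain ⟨t, ht⟩ := nonempty_preirreducible_inter V.isOpen (F ⁻¹ᵁ Y.basicOpen f).isOpen
    (Set.nonempty_coe_sort.mp ‹_›) ⟨x, hx⟩
  have hbot : T.basicOpen ((F.appLE U V h).hom f) = ⊥ := by rw [hf, Scheme.basicOpen_zero]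
  rw [Scheme.basicOpen_appLE] at hbot
  exact hbot.le ht

namespace GradedCone

variable {k : Type u} [Field k] [IsAlgClosed k] {r w : ℕ} {X X' : GradedCone k r w}

theorem EquivariantHom.d_le (p : X'.EquivariantHom X) [IsDominant p.total] : X'.d ≤ X.d := by
  obtain ⟨y⟩ : Nonempty X.S := inferInstance
  obtain ⟨U₀, hU₀, hy, -⟩ := exists_isAffineOpen_mem_and_subset
    (TopologicalSpace.Opens.mem_top y)
  have : Nonempty U₀ := ⟨y, hy⟩
  obtain ⟨U, _, -, c, s, hs⟩ := X.exists_isSlice ⟨U₀, hU₀⟩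
  obtain ⟨U', _, hU'⟩ := p.exists_affineOpens_le_preimage U
  have h := p.preimage_le hU'
  have hle := X'.d_add_card_le_of_isSlice
    (hs.map (p.map_coaction U U' h hU') (p.map_mem U U' h hU' w))
  rw [Fintype.card_fin] at hle
  have := X.d_le
  omega

theorem exists_transverse_ne_zero_of_e_lt_top [CharZero k] (hw : 0 < w) (he : X.e < ⊤) :
    ∃ n : ℕ, n ≤ X.e ∧ ∃ U : X.S.affineOpens, Nonempty U.1 ∧
      ∃ (c : Fin (r - X.d) → Fin r) (s : _), (X.coaction U).IsSlice w (X.𝒜 U) c s ∧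
        ∃ f ∈ X.𝒜 U (n + w), f ∈ (X.coaction U).centreIdeal (X.𝒜 U) ∧
          ∃ i, (X.coaction U).transverse c s i f ≠ 0 := by
  obtain ⟨e, heq, U₀, x, hx, hxe, hx0⟩ := X.exists_mem_fit_of_e_lt_top he
  have := X.nonempty_of_ne_zero hx0
  obtain ⟨U, _, hU, c, s, hs⟩ := X.exists_isSlice U₀
  let : Algebra ℚ Γ(X.C, X.π ⁻¹ᵁ U.1) :=
    ((scalar (X.π ≫ X.str) _).comp (algebraMap ℚ k)).toAlgebra
  have hd := X.d_le
  obtain ⟨n, hn, f, hf, hfJ, hne⟩ := hs.exists_transverse_ne_zero (X.isHomogeneous U) hw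
    (fun f hf i => X.transverse_eq_zero_of_isSlice hs (by rw [Fintype.card_fin]; omega) hf i)
    (by rw [Fintype.card_fin]; omega)
    (GaCoaction.map_mem_fit (X.coaction_res U₀ U hU) hx) (X.res_mem U₀ U hU e x hxe)
    ((map_ne_zero_iff _ (X.preimageRes_injective hU)).mpr hx0)
  exact ⟨n, heq ▸ mod_cast hn, U, ‹_›, c, s, hs, f, hf, hfJ, hne⟩

theorem EquivariantHom.e_lt [CharZero k] (hw : 0 < w) (p : X'.EquivariantHom X)
    [IsDominant p.total] (hp : X.PullsBackToCartier X.centre p.total) (he : X.e < ⊤)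
    (hd : X'.d = X.d) : X'.e < X.e := by
  obtain ⟨n, hn, U, _, c, s, hs, f, hf, hfJ, i, hi⟩ := exists_transverse_ne_zero_of_e_lt_top hw he
  obtain ⟨U', _, hU'⟩ := p.exists_affineOpens_le_preimage U
  have h := p.preimage_le hU'
  -- The ideal of the centre is principal in the local ring `O` at the generic point of the
  -- zero section of `C'`.
  let hA := X'.isAffineOpen_preimage U'
  have hprime := isPrime_irrelevant (X'.𝒜 U')
  let y : PrimeSpectrum Γ(X'.C, X'.π ⁻¹ᵁ U'.1) := ⟨_, hprime⟩
  have hy : hA.fromSpec y ∈ X'.π ⁻¹ᵁ U'.1 := (hA.isoSpec.inv y).2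
  let O := X'.C.presheaf.stalk (hA.fromSpec y)
  let : Algebra Γ(X'.C, X'.π ⁻¹ᵁ U'.1) O :=
    X'.C.presheaf.algebra_section_stalk ⟨hA.fromSpec y, hy⟩
  have : IsLocalization.AtPrime O (HomogeneousIdeal.irrelevant (X'.𝒜 U')).toIdeal :=
    hA.isLocalization_stalk' y hy
  obtain ⟨γ, hγ, hJ⟩ := hp.exists_map_germ_eq_span U h hy
  rw [X.centre_eq] at hJ
  have hd_le := X.d_le
  obtain ⟨m, hm, g, hg, hgm, hg0⟩ := hs.exists_mem_fit_degree_lt hw (X.isHomogeneous U)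
    (X'.isHomogeneous U') (p.map_coaction U U' h hU') (p.map_mem U U' h hU')
    (appLE_injective_of_isDominant p.total h) hγ hJ (j := (X'.d : ℤ) - 1)
    (by rw [Fintype.card_fin]; omega) hf hfJ hi
  have hem : X'.e ≤ m := sInf_le ⟨m, ⟨U', g, hg, hgm, hg0⟩, rfl⟩
  exact hem.trans_lt ((Nat.cast_lt.mpr hm).trans_le hn)

end GradedCone

end

theorem proposition5p2_general {k : Type u} [Field k] [IsAlgClosed k] [CharZero k] {r w : ℕ}
    (hw : 0 < w) {X X' : GradedCone k r w} (p : X'.EquivariantHom X) [IsDominant p.total]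
    (hp : X.PullsBackToCartier X.centre p.total) (he : X.e < ⊤) : X'.index < X.index := by
  rw [GradedCone.index, GradedCone.index, Prod.Lex.toLex_lt_toLex]
  rcases p.d_le.lt_or_eq with hlt | heq
  · exact Or.inl hlt
  · exact Or.inr ⟨heq, p.e_lt hw hp he heq⟩

theorem proposition5p2 {k : Type u} [Field k] [IsAlgClosed k] [CharZero k] {r w : ℕ}
    (hw : 0 < w) (X : GradedCone k r w)
    (hd : ∀ z ∈ X.zeroSection, Module.finrank k (X.stab z) = X.d) (he : X.e < ⊤)
    (X' : GradedCone k r w) (M : X.Modification X.centre X') :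
    X'.index < X.index :=
  have : IsDominant M.equivariantHom.total := M.isDominant
  proposition5p2_general hw M.equivariantHom M.pullsBackToCartier he
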